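/- Let $X$ be a locally compact Hausdorff space, $\mathfrak M$ the set of real-valued Radon measures on $X$, and, for $E\subset X$ closed, $\mathfrak M^+(E)$ the set of nonnegative Radon measures supported by $E$, with the vague topology (pointwise convergence on continuous functions with compact support). **Kernel.** Let $\kappa:X\times X\to(-\infty,\infty]$ be lower semicontinuous, and nonnegative unless $X$ is compact. For $\nu,\nu_1\in\mathfrak M$ write $\kappa(x,\nu)=\int\kappa(x,y)\,d\nu(y)$ and $\kappa(\nu,\nu_1)=\int\kappa\,d(\nu\otimes\nu_1)$ whenever well defined; $\mathcal E$ is the set of all $\nu\in\mathfrak M$ with $-\infty<\kappa(\nu,\nu)<\infty$, and $\mathcal E^+$ its subset of nonnegative measures. Assume that $\kappa$ is positive definite, i.e. symmetric with $\kappa(\nu,\nu)\ge0$ for every $\nu\in\mathfrak M$ for which it is well defined; $\|\nu\|=\sqrt{\kappa(\nu,\nu)}$ is then a seminorm on $\mathcal E$. Assume that $\kappa$ is consistent, i.e. has at least one of the following (equivalent) properties: (C$_1$) every $\|\cdot\|$-Cauchy net in $\mathcal E^+$ converges in $\|\cdot\|$ to each of its vague cluster points; (C$_2$) every $\|\cdot\|$-bounded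 vaguely convergent net $(\mu_s)$ in $\mathcal E^+$ converges weakly to its vague limit $\mu_0$, i.e. $\mu_0\in\mathcal E^+$ and $\kappa(\mu_s,\nu)\to\kappa(\mu_0,\nu)$ for all $\nu\in\mathcal E$. The interior capacity of $E\subset X$ is $C(E)=1/\inf\kappa(\mu,\mu)$, the infimum over all nonnegative Radon measures $\mu$ with $\mu(X)=1$ and compact support contained in $E$ ($1/0=\infty$, $1/\infty=0$, $\inf\varnothing=\infty$). A property holds nearly everywhere (n.e.) in $E$ if the set of points of $E$ where it fails has interior capacity zero. **Condenser.** Let $I=I^+\cup I^-$ be a countable index set, $I^+\cap I^-=\varnothing$, and let $\mathbf A=(A_i)_{i\in I}$ be a family of nonempty closed subsets of $X$ such that every compact set meets only finitely many $A_i$ and $A_i\cap A_j=\varnothing$ for $i\in I^+$, $j\in I^-$. Put $\alpha_i=\pm1$ for $i\in I^\pm$ and $A^\pm=\bigcup_{i\in I^\pm}A_i$. Let $\mathfrak M(\mathbf A)=\prod_{i\in I}\mathfrak M^+(A_i)$, with the product topology (the $\mathbf A$-vague topology). The energy of $\mu=(\mu^i)_{i\in I}\in\mathfrak M(\mathbf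 A)$ is $\kappa(\mu,\mu):=\kappa(R\mu,R\mu)$, where $R\mu=\sum_{i\in I}\alpha_i\mu^i\in\mathfrak M$. Let $\mathbf g=(g_i)_{i\in I}$ with $g_i:X\to(0,\infty)$ continuous and $\mathbf a=(a_i)_{i\in I}$ with $a_i>0$. Let $\mathcal E(\mathbf A,\mathbf a,\mathbf g)$ be the set of all $\mu\in\mathfrak M(\mathbf A)$ with finite energy and $\int g_i\,d\mu^i=a_i$ for all $i\in I$, and let $\mathrm{cap}(\mathbf A,\mathbf a,\mathbf g)=1/\inf_{\mu\in\mathcal E(\mathbf A,\mathbf a,\mathbf g)}\kappa(\mu,\mu)$. Assume $\mathrm{cap}(\mathbf A,\mathbf a,\mathbf g)>0$ (equivalently, $\mathcal E(\mathbf A,\mathbf a,\mathbf g)\ne\varnothing$), and that either $I^-=\varnothing$, or $$\sum_{i\in I}\frac{a_i}{\inf_{A_i}g_i}<\infty\quad\text{and}\quad\sup_{x\in A^+,\,y\in A^-}\kappa(x,y)<\infty .$$ **Theorem.** Suppose that for every $i\in I$: 1. either $\sup_{A_i}g_i<\infty$, or there are $r_i\in(1,\infty)$ and $\omega_i\in\mathcal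 E$ with $g_i(x)^{r_i}\le\kappa(x,\omega_i)$ n.e. in $A_i$; 2. $A_i$ is compact or $C(A_i)<\infty$. Then the set $\mathfrak S(\mathbf A,\mathbf a,\mathbf g)$ of all $\lambda\in\mathcal E(\mathbf A,\mathbf a,\mathbf g)$ with $\kappa(\lambda,\lambda)=\inf_{\mu\in\mathcal E(\mathbf A,\mathbf a,\mathbf g)}\kappa(\mu,\mu)$ is nonempty and compact in the $\mathbf A$-vague topology. -/

import Mathlib

open MeasureTheory Set Filter Topology
open scoped ENNReal CompactlySupported

noncomputable section

namespace CondenserEnergy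

/-! ### The function classes, Radon measures and the vague topology -/

/-- The class `Φ(Y)`: lower semicontinuous functions `Y → (-∞, ∞]`, nonnegative unless `Y` is
compact. -/
structure IsPhi {Y : Type*} [TopologicalSpace Y] (ψ : Y → EReal) : Prop where
  lsc : LowerSemicontinuous ψ
  ne_bot : ∀ y, ψ y ≠ ⊥
  nonneg : ¬ CompactSpace Y → ∀ y, 0 ≤ ψ y

/-- Nonnegative Radon measures on a locally compact Hausdorff space. By the Riesz representation
theorem, regular Borel measures (finite on compact sets, outer regular, and inner regular on open
sets with respect to compact sets) correspond bijectively to positive linear functionals on the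
continuous functions with compact support. -/
structure PosRadon (X : Type*) [TopologicalSpace X] [MeasurableSpace X] where
  toMeasure : Measure X
  regular : toMeasure.Regular

section Measures

variable {X : Type*} [TopologicalSpace X] [MeasurableSpace X]

/-- The vague topology: pointwise convergence on continuous functions with compact support. -/
instance PosRadon.vagueTopology : TopologicalSpace (PosRadon X) :=
  TopologicalSpace.induced
    (fun (μ : PosRadon X) (φ : C_c(X, ℝ)) => ∫ x, φ x ∂μ.toMeasure) Pi.topologicalSpace

instance : Zero (PosRadon X) := ⟨⟨0, inferInstance⟩⟩

@[simp] theorem PosRadon.zero_toMeasure : (0 : PosRadon X).toMeasure = 0 := rfl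

/-- `𝔐⁺(E)`: the nonnegative Radon measures supported by the closed set `E`. -/
abbrev MPlus (E : Set X) : Type _ := {μ : PosRadon X // μ.toMeasure Eᶜ = 0}

end Measures

/-- Real-valued Radon measures, given by their Jordan decomposition `ν = ν⁺ - ν⁻`. As the
measures need not be `σ`-finite, the disjointness of `ν⁺` and `ν⁻` is tested on compact sets. -/
structure Radon (X : Type*) [TopologicalSpace X] [MeasurableSpace X] where
  pos : PosRadon X
  neg : PosRadon X
  singular : ∀ K : Set X, IsCompact K →
    (pos.toMeasure.restrict K).MutuallySingular (neg.toMeasure.restrict K)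

section Energy

variable {X : Type*} [TopologicalSpace X] [MeasurableSpace X]

/-- A nonnegative Radon measure regarded as a real-valued one. -/
def PosRadon.toRadon (μ : PosRadon X) : Radon X where
  pos := μ
  neg := 0
  singular := by simp

/-- The extended integral `∫ f dμ = ∫ f⁺ dμ - ∫ f⁻ dμ`. In the uses below `f` belongs to `Φ(X)` and
`μ` is a Radon measure, so `∫ f⁻ dμ` is finite. -/
def eint (μ : Measure X) (f : X → EReal) : EReal :=
  ((∫⁻ x, (f x).toENNReal ∂μ : ℝ≥0∞) : EReal) - ((∫⁻ x, (-f x).toENNReal ∂μ : ℝ≥0∞) : EReal)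

/-- The potential `κ(x, ν) = ∫ κ(x, y) dν(y)` of a nonnegative Radon measure. -/
def posPotential (κ : X → X → EReal) (ν : PosRadon X) (x : X) : EReal :=
  eint ν.toMeasure (κ x)

/-- `∫ κ d(μ ⊗ ν)` for nonnegative Radon measures `μ`, `ν`. For kernels the integral against the
Radon product measure equals this iterated integral (Fubini's theorem for lower semicontinuous
functions); the iterated form avoids the Borel `σ`-algebra of `X × X`, which may be larger than the
product `σ`-algebra. -/
def posMutual (κ : X → X → EReal) (μ ν : PosRadon X) : EReal :=
  eint μ.toMeasure (posPotential κ ν)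

/-- `∫ κ d(ν ⊗ ν₁)⁺`. -/
def mutualPos (κ : X → X → EReal) (ν ν₁ : Radon X) : EReal :=
  posMutual κ ν.pos ν₁.pos + posMutual κ ν.neg ν₁.neg

/-- `∫ κ d(ν ⊗ ν₁)⁻`. -/
def mutualNeg (κ : X → X → EReal) (ν ν₁ : Radon X) : EReal :=
  posMutual κ ν.pos ν₁.neg + posMutual κ ν.neg ν₁.pos

/-- The mutual energy `κ(ν, ν₁) = ∫ κ d(ν ⊗ ν₁)`. It is well defined unless it is of the form
`∞ - ∞`; in that case the value here is `⊥`. -/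
def mutualEnergy (κ : X → X → EReal) (ν ν₁ : Radon X) : EReal :=
  mutualPos κ ν ν₁ - mutualNeg κ ν ν₁

theorem mutualEnergy_toRadon (κ : X → X → EReal) (μ ν : PosRadon X) :
    mutualEnergy κ μ.toRadon ν.toRadon = posMutual κ μ ν := by
  simp [mutualEnergy, mutualPos, mutualNeg, posMutual, posPotential, eint, PosRadon.toRadon]

/-- `κ(ν, ν₁)` is well defined. -/
def MutualDefined (κ : X → X → EReal) (ν ν₁ : Radon X) : Prop :=
  ¬ (mutualPos κ ν ν₁ = ⊤ ∧ mutualNeg κ ν ν₁ = ⊤)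

/-- The potential `κ(x, ν)` of a real-valued Radon measure; it takes the value `⊥` where it is of
the undefined form `∞ - ∞`. -/
def potential (κ : X → X → EReal) (ν : Radon X) (x : X) : EReal :=
  posPotential κ ν.pos x - posPotential κ ν.neg x

/-- `ℰ`: the real-valued Radon measures `ν` with `-∞ < κ(ν, ν) < ∞`. -/
def FiniteEnergy (κ : X → X → EReal) : Set (Radon X) :=
  {ν | mutualEnergy κ ν ν ≠ ⊥ ∧ mutualEnergy κ ν ν ≠ ⊤}

/-- `ℰ⁺`. -/
def FiniteEnergyPlus (κ : X → X → EReal) : Set (PosRadon X) :=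
  {μ | μ.toRadon ∈ FiniteEnergy κ}

/-- A kernel on `X` is an element of `Φ(X × X)`. -/
def IsKernel (κ : X → X → EReal) : Prop :=
  IsPhi (fun p : X × X => κ p.1 p.2)

/-- Positive definiteness: symmetry, and `κ(ν, ν) ≥ 0` whenever it is well defined. -/
def IsPosDef (κ : X → X → EReal) : Prop :=
  (∀ x y, κ x y = κ y x) ∧ ∀ ν : Radon X, MutualDefined κ ν ν → 0 ≤ mutualEnergy κ ν ν

/-- `‖μ - ν‖² = κ(μ, μ) + κ(ν, ν) - 2 κ(μ, ν)`, for `μ, ν ∈ ℰ`. -/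
def normSubSq (κ : X → X → EReal) (μ ν : Radon X) : ℝ :=
  (mutualEnergy κ μ μ).toReal + (mutualEnergy κ ν ν).toReal - 2 * (mutualEnergy κ μ ν).toReal

/-- Every strong Cauchy net in `ℰ⁺` converges strongly to each of its vague cluster points (nets
are replaced by filters). -/
def PropertyC1 (κ : X → X → EReal) : Prop :=
  ∀ F : Filter (PosRadon X), F.NeBot → FiniteEnergyPlus κ ∈ F →
    (∀ ε : ℝ, 0 < ε → ∃ S ∈ F, ∀ μ ∈ S, ∀ ν ∈ S, normSubSq κ μ.toRadon ν.toRadon < ε) →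
    ∀ μ₀ : PosRadon X, ClusterPt μ₀ F →
      μ₀ ∈ FiniteEnergyPlus κ ∧
        Tendsto (fun μ : PosRadon X => normSubSq κ μ.toRadon μ₀.toRadon) F (𝓝 0)

/-- Every strongly bounded and vaguely convergent net in `ℰ⁺` converges weakly to its vague
limit. -/
def PropertyC2 (κ : X → X → EReal) : Prop :=
  ∀ F : Filter (PosRadon X), F.NeBot → FiniteEnergyPlus κ ∈ F →
    (∃ C : ℝ, ∀ᶠ μ in F, mutualEnergy κ μ.toRadon μ.toRadon ≤ (C : EReal)) →
    ∀ μ₀ : PosRadon X, F ≤ 𝓝 μ₀ →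
      μ₀ ∈ FiniteEnergyPlus κ ∧
        ∀ ν ∈ FiniteEnergy κ,
          Tendsto (fun μ : PosRadon X => (mutualEnergy κ μ.toRadon ν).toReal) F
            (𝓝 (mutualEnergy κ μ₀.toRadon ν).toReal)

/-- A (positive definite) kernel is consistent if it has either of the two properties. -/
def IsConsistent (κ : X → X → EReal) : Prop := PropertyC1 κ ∨ PropertyC2 κ

/-- The interior capacity `C(E) = 1 / inf κ(μ, μ)`, the infimum being over the nonnegative Radon
measures `μ` of total mass `1` with compact support contained in `E`; `1 / 0 = ∞`, `1 / ∞ = 0`. -/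
def interiorCapacity (κ : X → X → EReal) (E : Set X) : ℝ≥0∞ :=
  (⨅ μ : PosRadon X,
    ⨅ _ : μ.toMeasure univ = 1 ∧ ∃ K : Set X, IsCompact K ∧ K ⊆ E ∧ μ.toMeasure Kᶜ = 0,
      (mutualEnergy κ μ.toRadon μ.toRadon).toENNReal)⁻¹

/-- `P` holds nearly everywhere in `E`: the exceptional set has interior capacity zero. -/
def NearlyEverywhere (κ : X → X → EReal) (E : Set X) (P : X → Prop) : Prop :=
  interiorCapacity κ {x ∈ E | ¬ P x} = 0

end Energy

/-! ### Condensers -/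

/-- A condenser with index set `ι`: the positive plates are those with index in `Ipos`, the
negative plates those with index in `Iposᶜ`. -/
structure Condenser (X : Type*) [TopologicalSpace X] (ι : Type*) where
  Ipos : Set ι
  plate : ι → Set X
  nonempty : ∀ i, (plate i).Nonempty
  closed : ∀ i, IsClosed (plate i)
  finite_inter : ∀ K : Set X, IsCompact K → {i | (plate i ∩ K).Nonempty}.Finite
  disjoint : ∀ i ∈ Ipos, ∀ j ∈ Iposᶜ, Disjoint (plate i) (plate j)

namespace Condenser

variable {X : Type*} [TopologicalSpace X] {ι : Type*}

/-- `I⁻`. -/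
def Ineg (A : Condenser X ι) : Set ι := A.Iposᶜ

/-- `A⁺`. -/
def posUnion (A : Condenser X ι) : Set X := ⋃ i ∈ A.Ipos, A.plate i

/-- `A⁻`. -/
def negUnion (A : Condenser X ι) : Set X := ⋃ i ∈ A.Ineg, A.plate i

theorem locallyFinite [LocallyCompactSpace X] (A : Condenser X ι) : LocallyFinite A.plate := by
  intro x
  obtain ⟨K, hK, hx⟩ := exists_compact_mem_nhds x
  exact ⟨K, hx, A.finite_inter K hK⟩

theorem isClosed_posUnion [LocallyCompactSpace X] (A : Condenser X ι) :
    IsClosed A.posUnion := by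
  have h : A.posUnion = ⋃ i : A.Ipos, A.plate i := by
    simp [posUnion, Set.iUnion_subtype]
  rw [h]
  exact (A.locallyFinite.comp_injective Subtype.val_injective).isClosed_iUnion
    (fun i => A.closed i)

variable [MeasurableSpace X]

/-- `𝔐(A)`: a measure `μ = ∑ αᵢ μⁱ` associated with the condenser is identified with the family
`(μⁱ)` of its coordinates. The product topology of the vague topologies on the `𝔐⁺(Aᵢ)` is the
`A`-vague topology. -/
abbrev Measures (A : Condenser X ι) : Type _ := (i : ι) → MPlus (A.plate i)

section Sum

variable [LocallyCompactSpace X] [BorelSpace X] [Countable ι]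

/-- A sum of coordinates of a measure associated with a condenser is a Radon measure. -/
theorem regular_sum (A : Condenser X ι) (μ : A.Measures) (J : Set ι) :
    (Measure.sum (fun i : J => (μ i).1.toMeasure)).Regular := by
  have hreg : ∀ i, (μ i).1.toMeasure.Regular := fun i => (μ i).1.regular
  refine { lt_top_of_isCompact := ?_, outerRegular := ?_, innerRegular := ?_ }
  · intro K hK
    rw [Measure.sum_apply_of_countable]
    have hfin : {i : J | (A.plate i.1 ∩ K).Nonempty}.Finite :=
      Set.Finite.preimage (f := Subtype.val) Subtype.val_injective.injOn (A.finite_inter K hK)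
    rw [tsum_eq_sum (s := hfin.toFinset)]
    · exact ENNReal.sum_lt_top.2 fun i _ => (hreg i).lt_top_of_isCompact hK
    · intro i hi
      have hi' : ¬ (A.plate i ∩ K).Nonempty := by simpa using hi
      refine measure_mono_null (fun x hx => ?_) (μ i).2
      exact fun hxA => hi' ⟨x, hxA, hx⟩
  · intro B _ r hr
    change Measure.sum (fun i : J => (μ i).1.toMeasure) B < r at hr
    rw [Measure.sum_apply_of_countable] at hr
    obtain ⟨ε, hε, hεr⟩ : ∃ ε : ℝ≥0∞, ε ≠ 0 ∧
        (∑' i : J, (μ i).1.toMeasure B) + ε < r := by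
      obtain ⟨t, ht, htr⟩ := exists_between hr
      refine ⟨t - ∑' i : J, (μ i).1.toMeasure B, (tsub_pos_of_lt ht).ne', ?_⟩
      rwa [add_tsub_cancel_of_le ht.le]
    obtain ⟨δ, hδ, hδε⟩ := ENNReal.exists_pos_sum_of_countable' hε J
    have hne : ∀ i : J, (μ i).1.toMeasure B ≠ ∞ := fun i =>
      ((ENNReal.le_tsum i).trans_lt (lt_of_lt_of_le hr le_top)).ne
    have hU : ∀ i : J, ∃ U ⊇ B, IsOpen U ∧
        (μ i).1.toMeasure U < (μ i).1.toMeasure B + δ i := fun i => by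
      have := (hreg i).toOuterRegular
      exact B.exists_isOpen_lt_add (hne i) (hδ i).ne'
    choose U hBU hUo hUlt using hU
    have hcl : IsClosed (⋃ i : J, A.plate i \ U i) := by
      refine LocallyFinite.isClosed_iUnion ?_ fun i => (A.closed i).sdiff (hUo i)
      exact (A.locallyFinite.comp_injective Subtype.val_injective).subset
        fun i => sdiff_subset
    refine ⟨(⋃ i : J, A.plate i \ U i)ᶜ, ?_, hcl.isOpen_compl, ?_⟩
    · intro x hx hx'
      obtain ⟨i, hi⟩ := mem_iUnion.1 hx'
      exact hi.2 (hBU i hx)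
    · rw [Measure.sum_apply_of_countable]
      calc ∑' i : J, (μ i).1.toMeasure (⋃ i : J, A.plate i \ U i)ᶜ
          ≤ ∑' i : J, ((μ i).1.toMeasure B + δ i) := by
            refine ENNReal.tsum_le_tsum fun i => le_trans ?_ (hUlt i).le
            have hsub : (⋃ i : J, A.plate i \ U i)ᶜ ⊆ U i ∪ (A.plate i)ᶜ := by
              intro x hx
              by_cases hxA : x ∈ A.plate i
              · by_cases hxU : x ∈ U i
                · exact Or.inl hxU
                · exact absurd (mem_iUnion_of_mem i (show x ∈ A.plate i \ U i from ⟨hxA, hxU⟩)) hx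
              · exact Or.inr hxA
            refine (measure_mono hsub).trans ((measure_union_le _ _).trans ?_)
            rw [(μ i).2, add_zero]
        _ = (∑' i : J, (μ i).1.toMeasure B) + ∑' i, δ i := ENNReal.tsum_add
        _ ≤ (∑' i : J, (μ i).1.toMeasure B) + ε := by gcongr
        _ < r := hεr
  · intro V hV r hr
    rw [Measure.sum_apply_of_countable, ENNReal.tsum_eq_iSup_sum] at hr
    obtain ⟨s, hs⟩ := lt_iSup_iff.1 hr
    have hsup : (∑ i ∈ s, (μ i).1.toMeasure V) =
        ⨆ K : {K : Set X // K ⊆ V ∧ IsCompact K}, ∑ i ∈ s, (μ i).1.toMeasure K.1 := by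
      have hdir : ∀ K L : {K : Set X // K ⊆ V ∧ IsCompact K},
          ∃ M : {K : Set X // K ⊆ V ∧ IsCompact K}, ∀ i : J,
            (μ i).1.toMeasure K.1 ≤ (μ i).1.toMeasure M.1 ∧
              (μ i).1.toMeasure L.1 ≤ (μ i).1.toMeasure M.1 := fun K L =>
        ⟨⟨K.1 ∪ L.1, union_subset K.2.1 L.2.1, K.2.2.union L.2.2⟩, fun i =>
          ⟨measure_mono subset_union_left, measure_mono subset_union_right⟩⟩
      rw [← ENNReal.finsetSum_iSup hdir]
      refine Finset.sum_congr rfl fun i _ => ?_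
      have := hreg i
      rw [hV.measure_eq_iSup_isCompact, iSup_subtype]
      simp only [iSup_and]
    rw [hsup] at hs
    obtain ⟨⟨K, hKV, hK⟩, hrK⟩ := lt_iSup_iff.1 hs
    refine ⟨K, hKV, hK, hrK.trans_le ?_⟩
    rw [Measure.sum_apply_of_countable]
    exact ENNReal.sum_le_tsum s

/-- The nonnegative Radon measure `∑_{i ∈ J} μⁱ`. -/
def sumOver (A : Condenser X ι) (μ : A.Measures) (J : Set ι) : PosRadon X where
  toMeasure := Measure.sum (fun i : J => (μ i).1.toMeasure)
  regular := A.regular_sum μ J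

theorem sumOver_singular (A : Condenser X ι) (μ : A.Measures) :
    (A.sumOver μ A.Ipos).toMeasure.MutuallySingular (A.sumOver μ A.Ineg).toMeasure := by
  refine ⟨A.posUnionᶜ, A.isClosed_posUnion.measurableSet.compl, ?_, ?_⟩
  · simp only [sumOver, Measure.sum_apply_of_countable, ENNReal.tsum_eq_zero]
    rintro ⟨i, hi⟩
    refine measure_mono_null (compl_subset_compl.2 ?_) (μ i).2
    exact subset_biUnion_of_mem (u := A.plate) hi
  · simp only [sumOver, Measure.sum_apply_of_countable, ENNReal.tsum_eq_zero, compl_compl]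
    rintro ⟨j, hj⟩
    refine measure_mono_null ?_ (μ j).2
    intro x hx hxj
    obtain ⟨i, hi, hxi⟩ := mem_iUnion₂.1 hx
    exact (A.disjoint i hi j hj).le_bot ⟨hxi, hxj⟩

/-- The real-valued Radon measure `Rμ = ∑ αᵢ μⁱ`, with Jordan decomposition
`Rμ⁺ = ∑_{i ∈ I⁺} μⁱ`, `Rμ⁻ = ∑_{i ∈ I⁻} μⁱ`. -/
def R (A : Condenser X ι) (μ : A.Measures) : Radon X where
  pos := A.sumOver μ A.Ipos
  neg := A.sumOver μ A.Ineg
  singular := fun _ _ =>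
    (A.sumOver_singular μ).mono Measure.restrict_le_self Measure.restrict_le_self

/-- The energy `κ(μ, μ) = κ(Rμ, Rμ)`. -/
def energy (A : Condenser X ι) (κ : X → X → EReal) (μ : A.Measures) : EReal :=
  mutualEnergy κ (A.R μ) (A.R μ)

/-- `ℰ(A, a, g)`: the measures associated with `A` of finite energy with `∫ gᵢ dμⁱ = aᵢ` for all
`i`. -/
def admissible (A : Condenser X ι) (κ : X → X → EReal) (a : ι → ℝ) (g : ι → X → ℝ) :
    Set A.Measures :=
  {μ | (∀ i, ∫⁻ x, ENNReal.ofReal (g i x) ∂(μ i).1.toMeasure = ENNReal.ofReal (a i)) ∧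
    A.R μ ∈ FiniteEnergy κ}

/-- `‖ℰ(A, a, g)‖²`: the infimum of the energy over `ℰ(A, a, g)`, equal to `+∞` if this class is
empty. -/
def minEnergy (A : Condenser X ι) (κ : X → X → EReal) (a : ι → ℝ) (g : ι → X → ℝ) : EReal :=
  ⨅ μ ∈ A.admissible κ a g, A.energy κ μ

/-- The interior capacity `cap (A, a, g) = 1 / ‖ℰ(A, a, g)‖²`, with `1 / 0 = ∞`. -/
def cap (A : Condenser X ι) (κ : X → X → EReal) (a : ι → ℝ) (g : ι → X → ℝ) : ℝ≥0∞ :=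
  ((A.minEnergy κ a g).toENNReal)⁻¹

/-- `𝔖(A, a, g)`: the class of all minimizers of the energy over `ℰ(A, a, g)`. -/
def minimizers (A : Condenser X ι) (κ : X → X → EReal) (a : ι → ℝ) (g : ι → X → ℝ) :
    Set A.Measures :=
  {μ ∈ A.admissible κ a g | A.energy κ μ = A.minEnergy κ a g}

end Sum

end Condenser

end CondenserEnergy

end

open CondenserEnergy

set_option linter.unusedSectionVars false

/-! The proof is the direct method. Existence and compactness both follow from one statement,
`exists_minimizer_of_ultrafilter`: an ultrafilter of admissible measures along which the energy
tends to its infimum converges `A`-vaguely to a minimizer. A minimizing sequence gives existence; an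
ultrafilter on the set of minimizers gives compactness.

Each `g i` is bounded away from zero on compact sets, so the constraints bound the coordinates
vaguely, and the Riesz theorem supplies vague limits. The standing assumption bounds the mutual
energy of the positive and negative halves of `Rμ`, so a bound on the energy of `Rμ` bounds the
energies of both halves. Consistency then upgrades vague convergence of the halves to weak
convergence, along which the energy is lower semicontinuous. From (C₁), weak convergence is obtained
by a filter version of passing to convex combinations (`exists_cauchy_filter`).

The delicate point is that the constraints `∫ gᵢ dμⁱ = aᵢ` survive in the limit. One inequality is
lower semicontinuity; the other requires that nothing escapes to infinity, which is only at issue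
when `X` is noncompact, hence `κ ≥ 0`. For a plate of finite capacity, the capacity outside large
compact sets is small (`exists_isCompact_interiorCapacity_sdiff_le`), so measures of bounded energy
have little mass there. The growth condition bounds `∫ gᵢ ^ r dμⁱ` by a mutual energy with `ω⁺`,
which makes `gᵢ` uniformly integrable.

Energies are handled as lower integrals of the nonnegative kernel `κ + c`. As Radon measures need
not be `σ`-finite, Fubini's theorem is derived from compactly supported continuous functions below
the kernel. -/

namespace CondenserEnergy

open scoped NNReal

/-! ### Radon measures and lower semicontinuous functions -/

section Lsc

variable {Y : Type*} [TopologicalSpace Y]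

/-- A compact subset of the union already lies in one member, so inner regularity on open sets
suffices, even for uncountable families. -/
theorem measure_iUnion_eq_iSup_of_directed_isOpen [MeasurableSpace Y] (μ : Measure Y) [μ.Regular]
    {I : Type*} [Nonempty I] {U : I → Set Y} (hU : ∀ i, IsOpen (U i))
    (hd : Directed (· ⊆ ·) U) : μ (⋃ i, U i) = ⨆ i, μ (U i) := by
  refine le_antisymm ?_ (iSup_le fun i => measure_mono (subset_iUnion U i))
  rw [(isOpen_iUnion hU).measure_eq_iSup_isCompact]
  refine iSup₂_le fun K hKU => iSup_le fun hK => ?_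
  obtain ⟨i, hi⟩ := hK.elim_directed_cover U hU hKU hd
  exact (measure_mono hi).trans (le_iSup (fun i => μ (U i)) i)

/-- Integration against a Radon measure commutes with suprema of upward directed families of
lower semicontinuous functions. -/
theorem lintegral_iSup_of_directed_lowerSemicontinuous [MeasurableSpace Y] [BorelSpace Y]
    (μ : Measure Y) [μ.Regular] {I : Type*} [Nonempty I] {F : I → Y → ℝ≥0∞}
    (hF : ∀ i, LowerSemicontinuous (F i)) (hd : Directed (· ≤ ·) F) :
    ∫⁻ y, ⨆ i, F i y ∂μ = ⨆ i, ∫⁻ y, F i y ∂μ := by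
  refine le_antisymm ?_ (iSup_le fun i => lintegral_mono fun y => le_iSup (fun i => F i y) i)
  let c : ℚ → ℝ≥0∞ := fun q => (Real.toNNReal q : ℝ≥0∞)
  -- For each pair of rationals `(p, q)` an index is fixed whose level set above `q` has measure
  -- above `p` whenever some index achieves this. A chain dominating these countably many indices
  -- has a supremum whose level sets have the same measures as those of the full supremum.
  have hex : ∀ pq : ℚ × ℚ, ∃ i, (∃ j, c pq.1 < μ {y | c pq.2 < F j y}) →
      c pq.1 < μ {y | c pq.2 < F i y} := fun pq => by
    by_cases h : ∃ j, c pq.1 < μ {y | c pq.2 < F j y}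
    · obtain ⟨j, hj⟩ := h
      exact ⟨j, fun _ => hj⟩
    · exact ⟨Classical.arbitrary I, fun h' => absurd h' h⟩
  choose e he using hex
  obtain ⟨enum, henum⟩ := exists_surjective_nat (ℚ × ℚ)
  choose d hd₁ hd₂ using hd
  let j : ℕ → I := fun n => Nat.rec (e (enum 0)) (fun n k => d k (e (enum (n + 1)))) n
  have hj_mono : Monotone fun n => F (j n) := monotone_nat_of_le_succ fun n => hd₁ _ _
  have hj : ∀ n, F (e (enum n)) ≤ F (j n) := fun n => by
    cases n with
    | zero => exact le_rfl
    | succ n => exact hd₂ _ _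
  have hmeas : ∀ q : ℚ, μ {y | c q < ⨆ i, F i y} = μ {y | c q < ⨆ n, F (j n) y} := fun q => by
    refine le_antisymm ?_ (measure_mono fun y hy => lt_of_lt_of_le hy
      (iSup_le fun n => le_iSup (fun i => F i y) (j n)))
    have hset : {y | c q < ⨆ i, F i y} = ⋃ i, {y | c q < F i y} := by
      ext y; simp [lt_iSup_iff]
    rw [hset, measure_iUnion_eq_iSup_of_directed_isOpen μ (U := fun i => {y | c q < F i y})
      (fun i => (hF i).isOpen_preimage _)]
    · refine le_of_forall_lt fun b hb => ?_
      obtain ⟨p, -, hbp, hp⟩ := ENNReal.lt_iff_exists_rat_btwn.1 hb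
      obtain ⟨i, hi⟩ := lt_iSup_iff.1 hp
      obtain ⟨n, hn⟩ := henum (p, q)
      refine hbp.trans ((he (p, q) ⟨i, hi⟩).trans_le (measure_mono fun y hy => ?_))
      refine lt_of_lt_of_le hy ((hn ▸ hj n y).trans (le_iSup (fun n => F (j n) y) n))
    · intro i k
      exact ⟨d i k, fun y hy => lt_of_lt_of_le hy (hd₁ i k y),
        fun y hy => lt_of_lt_of_le hy (hd₂ i k y)⟩
  have hle : ∫⁻ y, ⨆ i, F i y ∂μ ≤ ∫⁻ y, ⨆ n, F (j n) y ∂μ := by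
    -- Nested sets of equal measure differ by a null set only if that measure is finite. A level set
    -- of infinite measure at positive height makes the right-hand integral infinite, by Markov's
    -- inequality.
    by_cases htop : ∃ q : ℚ, c q ≠ 0 ∧ μ {y | c q < ⨆ i, F i y} = ⊤
    · obtain ⟨q, hq0, hq⟩ := htop
      have h := mul_meas_ge_le_lintegral (μ := μ) (f := fun y => ⨆ n, F (j n) y)
        (.iSup fun n => (hF (j n)).measurable) (c q)
      have h2 : μ {y | c q ≤ ⨆ n, F (j n) y} = ⊤ := by
        rw [hmeas] at hq
        exact top_le_iff.1 (hq ▸ measure_mono fun y (hy : c q < _) => hy.le)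
      rw [h2, ENNReal.mul_top hq0] at h
      exact le_top.trans h
    · push Not at htop
      refine lintegral_mono_ae ?_
      have hnull : ∀ q : ℚ, c q ≠ 0 →
          μ ({y | c q < ⨆ i, F i y} \ {y | c q < ⨆ n, F (j n) y}) = 0 := fun q hq => by
        rw [measure_sdiff, hmeas, tsub_self]
        · exact fun y hy => lt_of_lt_of_le hy (iSup_le fun n => le_iSup (fun i => F i y) (j n))
        · exact (measurableSet_lt measurable_const
            (.iSup fun n => (hF (j n)).measurable)).nullMeasurableSet
        · exact hmeas q ▸ htop q hq
      have hnull' : μ (⋃ q : {q : ℚ // c q ≠ 0},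
          ({y | c q < ⨆ i, F i y} \ {y | c q < ⨆ n, F (j n) y})) = 0 :=
        measure_iUnion_null fun q => hnull q q.2
      refine measure_mono_null (fun y hy => ?_) hnull'
      have hy' : (⨆ n, F (j n) y) < ⨆ i, F i y := not_le.1 hy
      obtain ⟨q, -, h1, h2⟩ := ENNReal.lt_iff_exists_rat_btwn.1 hy'
      exact mem_iUnion.2 ⟨⟨q, (pos_of_gt h1).ne'⟩, h2, h1.le.not_gt⟩
  refine hle.trans ?_
  rw [lintegral_iSup (fun n => (hF (j n)).measurable) hj_mono]
  exact iSup_le fun n => le_iSup (fun i => ∫⁻ y, F i y ∂μ) (j n)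

/-- The continuous functions with compact support lying between `0` and `f`. -/
abbrev CcBelow (f : Y → ℝ≥0∞) : Type _ := {φ : C_c(Y, ℝ≥0) // ∀ y, (φ y : ℝ≥0∞) ≤ f y}

instance (f : Y → ℝ≥0∞) : Nonempty (CcBelow f) := ⟨⟨0, by simp⟩⟩

theorem CcBelow.directed (f : Y → ℝ≥0∞) :
    Directed (· ≤ ·) fun (φ : CcBelow f) (y : Y) => (φ.1 y : ℝ≥0∞) := fun φ ψ =>
  ⟨⟨φ.1 ⊔ ψ.1, fun y => by
      rcases le_total (φ.1 y) (ψ.1 y) with h | h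
      · simpa [h] using ψ.2 y
      · simpa [h] using φ.2 y⟩,
    fun y => by simp, fun y => by simp⟩

/-- For `r < f y`, Urysohn's lemma yields a function of height `r` attaining `r` at `y` and
supported in the open set `{r < f}`. -/
theorem iSup_ccBelow [T2Space Y] [LocallyCompactSpace Y] {f : Y → ℝ≥0∞}
    (hf : LowerSemicontinuous f) (y : Y) : ⨆ φ : CcBelow f, (φ.1 y : ℝ≥0∞) = f y := by
  refine le_antisymm (iSup_le fun φ => φ.2 y) (le_of_forall_lt fun b hb => ?_)
  obtain ⟨r, hbr, hr⟩ := ENNReal.lt_iff_exists_nnreal_btwn.1 hb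
  obtain ⟨ψ, hψ1, hψc, hψs, hψ⟩ := exists_continuousMap_one_of_isCompact_subset_isOpen
    (isCompact_singleton (x := y)) (hf.isOpen_preimage (r : ℝ≥0∞)) (by simpa using hr)
  let φ : C_c(Y, ℝ≥0) :=
    { toFun := fun z => r * (ψ z).toNNReal
      continuous_toFun := by fun_prop
      hasCompactSupport' := by
        refine HasCompactSupport.intro hψc fun z hz => ?_
        simp [image_eq_zero_of_notMem_tsupport hz] }
  have hφ : ∀ z, φ z = r * (ψ z).toNNReal := fun _ => rfl
  refine hbr.trans_le (le_trans ?_ (le_iSup (fun φ : CcBelow f => (φ.1 y : ℝ≥0∞)) ⟨φ, fun z => ?_⟩))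
  · simp [hφ, hψ1 (mem_singleton y)]
  · by_cases hz : z ∈ tsupport ψ
    · have h1 : (φ z : ℝ≥0∞) ≤ r := by
        rw [hφ]
        have : (ψ z).toNNReal ≤ 1 := by simpa using (hψ z).2
        exact_mod_cast mul_le_of_le_one_right' this
      exact h1.trans (le_of_lt (hψs hz))
    · simp [hφ, image_eq_zero_of_notMem_tsupport hz]

theorem lintegral_eq_iSup_ccBelow [T2Space Y] [LocallyCompactSpace Y] [MeasurableSpace Y]
    [BorelSpace Y] (μ : Measure Y) [μ.Regular] {f : Y → ℝ≥0∞} (hf : LowerSemicontinuous f) :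
    ∫⁻ y, f y ∂μ = ⨆ φ : CcBelow f, ∫⁻ y, (φ.1 y : ℝ≥0∞) ∂μ := by
  rw [← lintegral_iSup_of_directed_lowerSemicontinuous μ _ (CcBelow.directed f)]
  · simp_rw [iSup_ccBelow hf]
  · exact fun φ => (ENNReal.continuous_coe.comp φ.1.continuous).lowerSemicontinuous

end Lsc

/-! ### Fubini's theorem for lower semicontinuous functions -/

section Fubini

variable {X : Type*} [TopologicalSpace X] [T2Space X] [LocallyCompactSpace X] [MeasurableSpace X]
  [BorelSpace X]

theorem lintegral_coe_cc (μ : Measure X) [IsFiniteMeasureOnCompacts μ] {f : X → ℝ≥0}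
    (hf : Continuous f) (hf' : HasCompactSupport f) :
    ∫⁻ x, (f x : ℝ≥0∞) ∂μ = ENNReal.ofReal (∫ x, (f x : ℝ) ∂μ) := by
  rw [ofReal_integral_eq_lintegral_ofReal]
  · simp
  · exact (NNReal.continuous_coe.comp hf).integrable_of_hasCompactSupport
      (hf'.comp_left (g := ((↑) : ℝ≥0 → ℝ)) rfl)
  · exact .of_forall fun x => NNReal.coe_nonneg _

theorem hasCompactSupport_slice (φ : C_c(X × X, ℝ≥0)) (x : X) :
    HasCompactSupport fun y => φ (x, y) := by
  refine HasCompactSupport.intro (φ.hasCompactSupport.isCompact.image continuous_snd) fun y hy => ?_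
  by_contra h
  exact hy ⟨(x, y), subset_tsupport _ h, rfl⟩

theorem lintegral_slice (ν : Measure X) [IsFiniteMeasureOnCompacts ν] (φ : C_c(X × X, ℝ≥0))
    (x : X) : ∫⁻ y, (φ (x, y) : ℝ≥0∞) ∂ν = ENNReal.ofReal (∫ y, (φ (x, y) : ℝ) ∂ν) :=
  lintegral_coe_cc ν (by fun_prop) (hasCompactSupport_slice φ x)

theorem continuous_integral_slice (ν : Measure X) [IsFiniteMeasureOnCompacts ν]
    (φ : C_c(X × X, ℝ≥0)) : Continuous fun x => ∫ y, (φ (x, y) : ℝ) ∂ν := by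
  rw [← continuousOn_univ]
  refine continuousOn_integral_of_compact_support
    (φ.hasCompactSupport.isCompact.image continuous_snd) ?_ fun x y _ hy => ?_
  · exact (NNReal.continuous_coe.comp φ.continuous).continuousOn
  · by_contra h
    exact hy ⟨(x, y), subset_tsupport _ fun h' => h (by simp [h']), rfl⟩

theorem continuous_lintegral_slice (ν : Measure X) [IsFiniteMeasureOnCompacts ν]
    (φ : C_c(X × X, ℝ≥0)) : Continuous fun x => ∫⁻ y, (φ (x, y) : ℝ≥0∞) ∂ν := by
  simp_rw [lintegral_slice]
  exact ENNReal.continuous_ofReal.comp (continuous_integral_slice ν φ)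

/-- For compactly supported continuous integrands the interchange needs no `σ`-finiteness. -/
theorem lintegral_lintegral_swap_cc (μ ν : Measure X) [IsFiniteMeasureOnCompacts μ]
    [IsFiniteMeasureOnCompacts ν] (φ : C_c(X × X, ℝ≥0)) :
    ∫⁻ x, ∫⁻ y, (φ (x, y) : ℝ≥0∞) ∂ν ∂μ = ∫⁻ y, ∫⁻ x, (φ (x, y) : ℝ≥0∞) ∂μ ∂ν := by
  have key : ∀ (μ ν : Measure X) [IsFiniteMeasureOnCompacts μ] [IsFiniteMeasureOnCompacts ν]
      (φ : C_c(X × X, ℝ≥0)), ∫⁻ x, ∫⁻ y, (φ (x, y) : ℝ≥0∞) ∂ν ∂μ =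
        ENNReal.ofReal (∫ x, ∫ y, (φ (x, y) : ℝ) ∂ν ∂μ) := by
    intro μ ν _ _ φ
    simp_rw [lintegral_slice]
    rw [ofReal_integral_eq_lintegral_ofReal]
    · refine (continuous_integral_slice ν φ).integrable_of_hasCompactSupport ?_
      refine HasCompactSupport.intro (φ.hasCompactSupport.isCompact.image continuous_fst)
        fun x hx => ?_
      have : ∀ y, φ (x, y) = 0 := fun y => by
        by_contra h
        exact hx ⟨(x, y), subset_tsupport _ h, rfl⟩
      simp [this]
    · exact .of_forall fun x => integral_nonneg fun y => NNReal.coe_nonneg _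
  rw [key, integral_integral_swap_of_hasCompactSupport]
  · let ψ : C_c(X × X, ℝ≥0) :=
      { toFun := fun p => φ (p.2, p.1)
        continuous_toFun := by fun_prop
        hasCompactSupport' :=
          φ.hasCompactSupport.comp_homeomorph (Homeomorph.prodComm X X) }
    exact (key ν μ ψ).symm
  · exact NNReal.continuous_coe.comp φ.continuous
  · exact φ.hasCompactSupport.comp_left (g := ((↑) : ℝ≥0 → ℝ)) rfl

variable {k : X → X → ℝ≥0∞}

theorem lintegral_kernel_eq_iSup (hk : LowerSemicontinuous fun p : X × X => k p.1 p.2)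
    (ν : Measure X) [ν.Regular] (x : X) :
    ∫⁻ y, k x y ∂ν = ⨆ φ : CcBelow fun p : X × X => k p.1 p.2,
      ∫⁻ y, (φ.1 (x, y) : ℝ≥0∞) ∂ν := by
  rw [← lintegral_iSup_of_directed_lowerSemicontinuous ν]
  · simp_rw [iSup_ccBelow hk]
  · exact fun φ => Continuous.lowerSemicontinuous (by fun_prop)
  · intro φ ψ
    obtain ⟨χ, h1, h2⟩ := CcBelow.directed (fun p : X × X => k p.1 p.2) φ ψ
    exact ⟨χ, fun y => h1 (x, y), fun y => h2 (x, y)⟩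

theorem lowerSemicontinuous_lintegral_kernel
    (hk : LowerSemicontinuous fun p : X × X => k p.1 p.2) (ν : Measure X) [ν.Regular] :
    LowerSemicontinuous fun x => ∫⁻ y, k x y ∂ν := by
  simp_rw [lintegral_kernel_eq_iSup hk ν]
  exact lowerSemicontinuous_iSup fun φ =>
    (continuous_lintegral_slice ν φ.1).lowerSemicontinuous

theorem lintegral_lintegral_kernel_eq_iSup
    (hk : LowerSemicontinuous fun p : X × X => k p.1 p.2) (μ ν : Measure X) [μ.Regular]
    [ν.Regular] :
    ∫⁻ x, ∫⁻ y, k x y ∂ν ∂μ = ⨆ φ : CcBelow fun p : X × X => k p.1 p.2,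
      ∫⁻ x, ∫⁻ y, (φ.1 (x, y) : ℝ≥0∞) ∂ν ∂μ := by
  simp_rw [lintegral_kernel_eq_iSup hk ν]
  refine lintegral_iSup_of_directed_lowerSemicontinuous μ
    (fun φ => (continuous_lintegral_slice ν φ.1).lowerSemicontinuous) fun φ ψ => ?_
  obtain ⟨χ, h1, h2⟩ := CcBelow.directed (fun p : X × X => k p.1 p.2) φ ψ
  exact ⟨χ, fun x => lintegral_mono fun y => h1 (x, y),
    fun x => lintegral_mono fun y => h2 (x, y)⟩

/-- Fubini's theorem for nonnegative lower semicontinuous functions and Radon measures. -/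
theorem lintegral_lintegral_kernel_swap
    (hk : LowerSemicontinuous fun p : X × X => k p.1 p.2) (μ ν : Measure X) [μ.Regular]
    [ν.Regular] : ∫⁻ x, ∫⁻ y, k x y ∂ν ∂μ = ∫⁻ y, ∫⁻ x, k x y ∂μ ∂ν := by
  have hk' : LowerSemicontinuous fun p : X × X => k p.2 p.1 := hk.comp continuous_swap
  refine le_antisymm ?_ ?_
  · rw [lintegral_lintegral_kernel_eq_iSup hk]
    refine iSup_le fun φ => ?_
    rw [lintegral_lintegral_swap_cc]
    exact lintegral_mono fun y => lintegral_mono fun x => φ.2 (x, y)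
  · rw [lintegral_lintegral_kernel_eq_iSup (k := fun y x => k x y) hk']
    refine iSup_le fun φ => ?_
    rw [lintegral_lintegral_swap_cc]
    exact lintegral_mono fun x => lintegral_mono fun y => φ.2 (y, x)

/-- Every compactly supported function below the kernel lives on some `K × K`. This extends
estimates from finite measures to arbitrary Radon measures. -/
theorem lintegral_lintegral_kernel_le_of_compacts
    (hk : LowerSemicontinuous fun p : X × X => k p.1 p.2) (μ ν : Measure X) [μ.Regular]
    [ν.Regular] {b : ℝ≥0∞}
    (h : ∀ K, IsCompact K → ∫⁻ x in K, ∫⁻ y in K, k x y ∂ν ∂μ ≤ b) :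
    ∫⁻ x, ∫⁻ y, k x y ∂ν ∂μ ≤ b := by
  rw [lintegral_lintegral_kernel_eq_iSup hk]
  refine iSup_le fun φ => ?_
  let K : Set X := Prod.fst '' tsupport φ.1 ∪ Prod.snd '' tsupport φ.1
  have hK : IsCompact K := (φ.1.hasCompactSupport.isCompact.image continuous_fst).union
    (φ.1.hasCompactSupport.isCompact.image continuous_snd)
  have h0 : ∀ x y, φ.1 (x, y) ≠ 0 → x ∈ K ∧ y ∈ K := fun x y hxy =>
    ⟨.inl ⟨(x, y), subset_tsupport _ hxy, rfl⟩, .inr ⟨(x, y), subset_tsupport _ hxy, rfl⟩⟩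
  refine le_trans ?_ (h K hK)
  have h1 : ∀ x, ∫⁻ y, (φ.1 (x, y) : ℝ≥0∞) ∂ν = ∫⁻ y in K, (φ.1 (x, y) : ℝ≥0∞) ∂ν := fun x => by
    rw [setLIntegral_eq_of_support_subset]
    intro y hy
    exact (h0 x y (by simpa using hy)).2
  have h2 : ∫⁻ x, ∫⁻ y, (φ.1 (x, y) : ℝ≥0∞) ∂ν ∂μ =
      ∫⁻ x in K, ∫⁻ y, (φ.1 (x, y) : ℝ≥0∞) ∂ν ∂μ := by
    rw [setLIntegral_eq_of_support_subset]
    intro x hx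
    by_contra hxK
    refine hx ?_
    have : ∀ y, φ.1 (x, y) = 0 := fun y => by
      by_contra hne
      exact hxK (h0 x y hne).1
    simp [this]
  rw [h2]
  refine lintegral_mono fun x => ?_
  rw [h1]
  exact lintegral_mono fun y => φ.2 (x, y)

end Fubini

/-! ### Operations on nonnegative Radon measures -/

section Operations

variable {X : Type*} [TopologicalSpace X] [T2Space X] [LocallyCompactSpace X] [MeasurableSpace X]
  [BorelSpace X]

instance (μ : PosRadon X) : μ.toMeasure.Regular := μ.regular

theorem PosRadon.ext {μ ν : PosRadon X} (h : μ.toMeasure = ν.toMeasure) : μ = ν := by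
  cases μ; cases ν; congr

theorem regular_add (μ ν : Measure X) [μ.Regular] [ν.Regular] : (μ + ν).Regular := by
  refine { lt_top_of_isCompact := ?_, outerRegular := ?_, innerRegular := ?_ }
  · intro K hK
    simp [hK.measure_lt_top]
  · intro B _ r hr
    rw [Measure.add_apply] at hr
    have hfin : μ B + ν B ≠ ⊤ := (hr.trans_le le_top).ne
    obtain ⟨δ, hδ, hδr⟩ : ∃ δ : ℝ≥0∞, δ ≠ 0 ∧ μ B + ν B + (δ + δ) < r := by
      obtain ⟨t, ht, htr⟩ := exists_between hr
      refine ⟨(t - (μ B + ν B)) / 2, ?_, ?_⟩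
      · exact (ENNReal.half_pos (tsub_pos_of_lt ht).ne').ne'
      · rwa [ENNReal.add_halves, add_tsub_cancel_of_le ht.le]
    obtain ⟨U, hBU, hU, hμU⟩ := B.exists_isOpen_lt_add (μ := μ) (ENNReal.add_ne_top.1 hfin).1 hδ
    obtain ⟨V, hBV, hV, hνV⟩ := B.exists_isOpen_lt_add (μ := ν) (ENNReal.add_ne_top.1 hfin).2 hδ
    refine ⟨U ∩ V, subset_inter hBU hBV, hU.inter hV, lt_of_le_of_lt ?_ hδr⟩
    rw [Measure.add_apply]
    calc μ (U ∩ V) + ν (U ∩ V) ≤ (μ B + δ) + (ν B + δ) :=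
          add_le_add ((measure_mono inter_subset_left).trans hμU.le)
            ((measure_mono inter_subset_right).trans hνV.le)
      _ = μ B + ν B + (δ + δ) := by ring
  · intro U hU r hr
    rw [Measure.add_apply, hU.measure_eq_iSup_isCompact, hU.measure_eq_iSup_isCompact] at hr
    simp only [iSup_and', iSup_subtype'] at hr
    rw [ENNReal.iSup_add_iSup] at hr
    · obtain ⟨⟨K, hKU, hK⟩, h⟩ := lt_iSup_iff.1 hr
      exact ⟨K, hKU, hK, by simpa using h⟩
    · rintro ⟨K, hKU, hK⟩ ⟨L, hLU, hL⟩
      exact ⟨⟨K ∪ L, union_subset hKU hLU, hK.union hL⟩,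
        add_le_add (measure_mono subset_union_left) (measure_mono subset_union_right)⟩

/-- Approximation errors `μ (U \ B)` and `μ (U \ K)` dominate those of `τ`. This makes the parts of
a Jordan decomposition Radon measures. -/
theorem regular_of_le {μ τ : Measure X} [μ.Regular] [IsFiniteMeasure μ] (h : τ ≤ μ) :
    τ.Regular := by
  refine { lt_top_of_isCompact := ?_, outerRegular := ?_, innerRegular := ?_ }
  · exact fun K hK => (h K).trans_lt hK.measure_lt_top
  · intro B hB r hr
    obtain ⟨U, hBU, hU, -, hlt⟩ := hB.exists_isOpen_sdiff_lt (measure_ne_top μ B)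
      (tsub_pos_of_lt hr).ne'
    refine ⟨U, hBU, hU, ?_⟩
    calc τ U ≤ τ B + τ (U \ B) := by
          rw [← union_sdiff_cancel hBU]
          exact (measure_union_le _ _).trans (by rw [union_sdiff_cancel hBU])
      _ < τ B + (r - τ B) := by
          refine ENNReal.add_lt_add_left (hr.trans_le le_top).ne ((h _).trans_lt hlt)
      _ = r := add_tsub_cancel_of_le hr.le
  · intro U hU r hr
    obtain ⟨K, hKU, hK, hlt⟩ := hU.measurableSet.exists_isCompact_sdiff_lt (measure_ne_top μ U)
      (tsub_pos_of_lt hr).ne'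
    refine ⟨K, hKU, hK, ?_⟩
    have h1 : τ U ≤ τ K + τ (U \ K) := by
      conv_lhs => rw [← union_sdiff_cancel hKU]
      exact measure_union_le _ _
    have h2 : τ (U \ K) < τ U - r := (h _).trans_lt hlt
    by_contra hcon
    have h3 : τ U < r + (τ U - r) := by
      refine h1.trans_lt (ENNReal.add_lt_add_of_le_of_lt ?_ (not_lt.1 hcon) h2)
      exact ((h K).trans_lt (measure_lt_top μ K)).ne
    rw [add_tsub_cancel_of_le hr.le] at h3
    exact lt_irrefl _ h3

instance : Add (PosRadon X) := ⟨fun μ ν => ⟨μ.toMeasure + ν.toMeasure, regular_add _ _⟩⟩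

noncomputable instance : SMul ℝ≥0 (PosRadon X) := ⟨fun t μ => ⟨t • μ.toMeasure, inferInstance⟩⟩

@[simp] theorem PosRadon.add_toMeasure (μ ν : PosRadon X) :
    (μ + ν).toMeasure = μ.toMeasure + ν.toMeasure := rfl

@[simp] theorem PosRadon.smul_toMeasure (t : ℝ≥0) (μ : PosRadon X) :
    (t • μ).toMeasure = t • μ.toMeasure := rfl

/-- The restriction of a Radon measure to a compact set. -/
noncomputable def PosRadon.restrict (μ : PosRadon X) (K : Set X) (hK : IsCompact K) : PosRadon X :=
  ⟨μ.toMeasure.restrict K, Measure.Regular.restrict_of_measure_ne_top hK.measure_lt_top.ne⟩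

@[simp] theorem PosRadon.restrict_toMeasure (μ : PosRadon X) (K : Set X) (hK : IsCompact K) :
    (μ.restrict K hK).toMeasure = μ.toMeasure.restrict K := rfl

/-- The Jordan decomposition of the difference of two finite Radon measures. -/
theorem exists_common_part (μ ν : PosRadon X) [IsFiniteMeasure μ.toMeasure]
    [IsFiniteMeasure ν.toMeasure] :
    ∃ ρ p n : PosRadon X, μ = ρ + p ∧ ν = ρ + n ∧ p.toMeasure.MutuallySingular n.toMeasure := by
  obtain ⟨s, hs, h1, h2⟩ := hahn_decomposition μ.toMeasure ν.toMeasure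
  have hle1 : ν.toMeasure.restrict s ≤ μ.toMeasure.restrict s := by
    refine Measure.le_iff.2 fun t ht => ?_
    rw [Measure.restrict_apply ht, Measure.restrict_apply ht]
    exact h1 _ (ht.inter hs) inter_subset_right
  have hle2 : μ.toMeasure.restrict sᶜ ≤ ν.toMeasure.restrict sᶜ := by
    refine Measure.le_iff.2 fun t ht => ?_
    rw [Measure.restrict_apply ht, Measure.restrict_apply ht]
    exact h2 _ (ht.inter hs.compl) inter_subset_right
  have hp := Measure.sub_add_cancel_of_le hle1
  have hn := Measure.sub_add_cancel_of_le hle2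
  have hps : μ.toMeasure.restrict s - ν.toMeasure.restrict s ≤ μ.toMeasure.restrict s :=
    Measure.sub_le
  have hns : ν.toMeasure.restrict sᶜ - μ.toMeasure.restrict sᶜ ≤ ν.toMeasure.restrict sᶜ :=
    Measure.sub_le
  -- The common part is the minimum of the two measures: `ν` on the Hahn set `s`, where `ν ≤ μ`, and
  -- `μ` off it.
  have hμ : μ.toMeasure = (ν.toMeasure.restrict s + μ.toMeasure.restrict sᶜ) +
      (μ.toMeasure.restrict s - ν.toMeasure.restrict s) := by
    conv_lhs => rw [← Measure.restrict_add_restrict_compl (μ := μ.toMeasure) hs, ← hp]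
    ac_rfl
  have hν : ν.toMeasure = (ν.toMeasure.restrict s + μ.toMeasure.restrict sᶜ) +
      (ν.toMeasure.restrict sᶜ - μ.toMeasure.restrict sᶜ) := by
    conv_lhs => rw [← Measure.restrict_add_restrict_compl (μ := ν.toMeasure) hs, ← hn]
    ac_rfl
  have hρ : ν.toMeasure.restrict s + μ.toMeasure.restrict sᶜ ≤ μ.toMeasure := by
    conv_rhs => rw [hμ]
    exact Measure.le_add_right le_rfl
  refine ⟨⟨_, regular_of_le hρ⟩, ⟨_, regular_of_le (hps.trans Measure.restrict_le_self)⟩,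
    ⟨_, regular_of_le (hns.trans Measure.restrict_le_self)⟩, PosRadon.ext hμ, PosRadon.ext hν,
    ⟨sᶜ, hs.compl, ?_, ?_⟩⟩
  · exact le_antisymm ((hps _).trans (by simp [hs.compl])) zero_le
  · exact le_antisymm ((hns _).trans (by simp [hs])) zero_le

end Operations

/-! ### Energies as lower Lebesgue integrals -/

section Shift

variable {X : Type*}

theorem ereal_sub_eq_sub {x y b h : ℝ≥0∞} (hb : b ≠ ⊤) (hy : y ≠ ⊤) (hxy : x + b = h + y) :
    (x : EReal) - (y : EReal) = (h : EReal) - (b : EReal) := by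
  lift b to ℝ≥0 using hb
  lift y to ℝ≥0 using hy
  induction x with
  | top =>
    have hh : h = ⊤ := by
      by_contra hne
      lift h to ℝ≥0 using hne
      rw [top_add] at hxy
      exact (ENNReal.add_ne_top.2 ⟨ENNReal.coe_ne_top, ENNReal.coe_ne_top⟩) hxy.symm
    subst hh
    rfl
  | coe x =>
    have hh : h ≠ ⊤ := by
      rintro rfl
      rw [top_add] at hxy
      exact (ENNReal.add_ne_top.2 ⟨ENNReal.coe_ne_top, ENNReal.coe_ne_top⟩) hxy
    lift h to ℝ≥0 using hh
    have hxy' : (x : ℝ) + b = h + y := by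
      rw [← ENNReal.coe_add, ← ENNReal.coe_add, ENNReal.coe_inj] at hxy
      exact_mod_cast hxy
    have : (x : ℝ) - y = h - b := by linarith
    simp only [EReal.coe_nnreal_eq_coe_real, ← EReal.coe_sub]
    exact_mod_cast this

/-- Pointwise `(h - b)⁺ + b = h + (b - h)⁺`. Integrating this identity leaves only finite terms to
be moved across it. -/
theorem eint_coe_sub [MeasurableSpace X] (μ : Measure X) {h : X → ℝ≥0∞} (hh : Measurable h)
    {b : ℝ≥0∞} (hb : b ≠ ⊤) (hbμ : b * μ univ ≠ ⊤) :
    eint μ (fun x => (h x : EReal) - (b : EReal)) =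
      ((∫⁻ x, h x ∂μ : ℝ≥0∞) : EReal) - ((b * μ univ : ℝ≥0∞) : EReal) := by
  have h1 : ∀ x, ((h x : EReal) - (b : EReal)).toENNReal = h x - b := fun x => by
    rw [EReal.toENNReal_sub (EReal.coe_ennreal_nonneg _)]; simp
  have h2 : ∀ x, (-((h x : EReal) - (b : EReal))).toENNReal = b - h x := fun x => by
    rw [EReal.neg_sub (.inl (by simp)) (.inr (by simpa using hb)), add_comm, ← sub_eq_add_neg,
      EReal.toENNReal_sub (EReal.coe_ennreal_nonneg _)]
    simp
  have hle : ∫⁻ x, (b - h x) ∂μ ≤ b * μ univ := by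
    rw [← lintegral_const]
    exact lintegral_mono fun x => tsub_le_self
  unfold eint
  simp_rw [h1, h2]
  refine ereal_sub_eq_sub hbμ (ne_top_of_le_ne_top hbμ hle) ?_
  rw [← lintegral_const, ← lintegral_add_right _ measurable_const, ← lintegral_add_left hh]
  refine lintegral_congr fun x => ?_
  rcases le_total (h x) b with hx | hx
  · rw [tsub_eq_zero_of_le hx, zero_add, add_tsub_cancel_of_le hx]
  · rw [tsub_eq_zero_of_le hx, add_zero, tsub_add_cancel_of_le hx]

/-- The kernel `κ + c`, truncated below at zero. -/
noncomputable def shiftKernel (κ : X → X → EReal) (c : ℝ≥0) (x y : X) : ℝ≥0∞ := (κ x y + (c : ℝ)).toENNReal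

/-- `κ ≥ -c`, where `c > 0` only if the space is compact. -/
structure LowerBoundedBy [TopologicalSpace X] (κ : X → X → EReal) (c : ℝ≥0) : Prop where
  le : ∀ x y, -((c : ℝ) : EReal) ≤ κ x y
  compact : c ≠ 0 → CompactSpace X

theorem IsKernel.exists_lowerBoundedBy [TopologicalSpace X] {κ : X → X → EReal}
    (hκ : IsKernel κ) : ∃ c : ℝ≥0, LowerBoundedBy κ c := by
  by_cases hX : CompactSpace X
  · rcases isEmpty_or_nonempty X with hE | hne
    · exact ⟨0, fun x => isEmptyElim x, fun h => absurd rfl h⟩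
    obtain ⟨⟨a, b⟩, -, hab⟩ := (hκ.lsc.lowerSemicontinuousOn univ).exists_isMinOn univ_nonempty
      isCompact_univ
    have hmin : ∀ x y, κ a b ≤ κ x y := fun x y => hab (mem_univ (x, y))
    have hnb : κ a b ≠ ⊥ := hκ.ne_bot (a, b)
    refine ⟨(-(κ a b).toReal).toNNReal, fun x y => le_trans ?_ (hmin x y), fun _ => hX⟩
    induction h : κ a b with
    | bot => exact absurd h hnb
    | top => exact le_top
    | coe r =>
      rw [EReal.toReal_coe, ← EReal.coe_neg, EReal.coe_le_coe_iff]
      have := Real.le_coe_toNNReal (-r)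
      linarith
  · refine ⟨0, fun x y => ?_, fun h => absurd rfl h⟩
    -- The kernel is nonnegative when `X × X` is noncompact; compactness of `X × X` would pass to
    -- `X` under the first projection.
    have : ¬ CompactSpace (X × X) := fun h => by
      refine hX ⟨?_⟩
      have h2 := h.isCompact_univ.image (continuous_fst (X := X) (Y := X))
      rwa [image_univ, range_eq_univ.2 fun x => ⟨(x, x), rfl⟩] at h2
    simpa using hκ.nonneg this (x, y)

theorem LowerBoundedBy.eq_sub [TopologicalSpace X] {κ : X → X → EReal} {c : ℝ≥0}
    (hc : LowerBoundedBy κ c) (x y : X) :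
    κ x y = (shiftKernel κ c x y : EReal) - ((c : ℝ≥0∞) : EReal) := by
  have h0 : 0 ≤ κ x y + (c : ℝ) := by
    have := add_le_add_left (hc.le x y) ((c : ℝ) : EReal)
    rwa [← EReal.coe_neg, ← EReal.coe_add, neg_add_cancel, EReal.coe_zero] at this
  rw [shiftKernel, EReal.coe_toENNReal h0]
  simp [EReal.coe_nnreal_eq_coe_real, EReal.add_sub_cancel_right]

theorem IsKernel.lowerSemicontinuous_shiftKernel [TopologicalSpace X] {κ : X → X → EReal}
    (hκ : IsKernel κ) (c : ℝ≥0) :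
    LowerSemicontinuous fun p : X × X => shiftKernel κ c p.1 p.2 := by
  have hcont : Continuous fun z : EReal => (z + (c : ℝ)).toENNReal := by
    refine EReal.continuous_toENNReal.comp (continuous_iff_continuousAt.2 fun z => ?_)
    exact (EReal.continuousAt_add (p := (z, ((c : ℝ) : EReal))) (.inr (by simp)) (.inr (by simp))).comp
      (f := fun z : EReal => (z, ((c : ℝ) : EReal))) (by fun_prop)
  refine hcont.comp_lowerSemicontinuous hκ.lsc fun z w hzw => ?_
  exact EReal.toENNReal_le_toENNReal (add_le_add_left hzw _)

end Shift

section Mutual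

variable {X : Type*} [TopologicalSpace X] [T2Space X] [LocallyCompactSpace X] [MeasurableSpace X]
  [BorelSpace X] {κ : X → X → EReal} {c : ℝ≥0}

/-- The constant is nonzero only on compact spaces, where Radon measures are finite. Hence the
correction terms between `κ` and `κ + c` are always finite. -/
theorem LowerBoundedBy.mul_univ_ne_top (hc : LowerBoundedBy κ c) (μ : PosRadon X) :
    (c : ℝ≥0∞) * μ.toMeasure univ ≠ ⊤ := by
  by_cases h0 : c = 0
  · simp [h0]
  · have := hc.compact h0
    exact ENNReal.mul_ne_top ENNReal.coe_ne_top isCompact_univ.measure_lt_top.ne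

/-- The mutual energy with respect to the nonnegative kernel `κ + c`. -/
noncomputable def shiftMutual (κ : X → X → EReal) (c : ℝ≥0) (μ ν : PosRadon X) : ℝ≥0∞ :=
  ∫⁻ x, ∫⁻ y, shiftKernel κ c x y ∂ν.toMeasure ∂μ.toMeasure

theorem measurable_shiftKernel (hκ : IsKernel κ) (c : ℝ≥0) (x : X) :
    Measurable (shiftKernel κ c x) :=
  ((hκ.lowerSemicontinuous_shiftKernel c).comp
    (g := fun y : X => (x, y)) (by fun_prop)).measurable

theorem measurable_shiftPotential (hκ : IsKernel κ) (c : ℝ≥0) (ν : PosRadon X) :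
    Measurable fun x => ∫⁻ y, shiftKernel κ c x y ∂ν.toMeasure :=
  (lowerSemicontinuous_lintegral_kernel (hκ.lowerSemicontinuous_shiftKernel c) _).measurable

theorem posPotential_eq (hκ : IsKernel κ) (hc : LowerBoundedBy κ c) (ν : PosRadon X) (x : X) :
    posPotential κ ν x = ((∫⁻ y, shiftKernel κ c x y ∂ν.toMeasure : ℝ≥0∞) : EReal) -
      ((c * ν.toMeasure univ : ℝ≥0∞) : EReal) := by
  rw [posPotential, ← eint_coe_sub _ (measurable_shiftKernel hκ c x) ENNReal.coe_ne_top
    (hc.mul_univ_ne_top ν)]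
  congr 1
  exact funext fun y => hc.eq_sub x y

theorem posMutual_eq (hκ : IsKernel κ) (hc : LowerBoundedBy κ c) (μ ν : PosRadon X) :
    posMutual κ μ ν = ((shiftMutual κ c μ ν : ℝ≥0∞) : EReal) -
      ((c * ν.toMeasure univ * μ.toMeasure univ : ℝ≥0∞) : EReal) := by
  rw [posMutual, shiftMutual, ← eint_coe_sub _ (measurable_shiftPotential hκ c ν)
    (hc.mul_univ_ne_top ν)]
  · congr 1
    exact funext fun x => posPotential_eq hκ hc ν x
  · by_cases h0 : c = 0
    · simp [h0]
    · have := hc.compact h0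
      exact ENNReal.mul_ne_top (hc.mul_univ_ne_top ν) isCompact_univ.measure_lt_top.ne

theorem shiftMutual_comm (hκ : IsKernel κ) (hsymm : ∀ x y, κ x y = κ y x) (μ ν : PosRadon X) :
    shiftMutual κ c μ ν = shiftMutual κ c ν μ := by
  rw [shiftMutual, lintegral_lintegral_kernel_swap (hκ.lowerSemicontinuous_shiftKernel c)]
  simp_rw [shiftMutual, shiftKernel, fun x y => hsymm y x]

theorem shiftMutual_mono {μ μ' ν ν' : PosRadon X} (hμ : μ.toMeasure ≤ μ'.toMeasure)
    (hν : ν.toMeasure ≤ ν'.toMeasure) : shiftMutual κ c μ ν ≤ shiftMutual κ c μ' ν' :=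
  lintegral_mono' hμ fun _ => lintegral_mono' hν le_rfl

theorem shiftMutual_add_left (μ μ' ν : PosRadon X) :
    shiftMutual κ c (μ + μ') ν = shiftMutual κ c μ ν + shiftMutual κ c μ' ν := by
  simp [shiftMutual, lintegral_add_measure]

theorem shiftMutual_smul_left (t : ℝ≥0) (μ ν : PosRadon X) :
    shiftMutual κ c (t • μ) ν = t * shiftMutual κ c μ ν := by
  rw [shiftMutual, shiftMutual, PosRadon.smul_toMeasure, lintegral_smul_measure]
  rfl

theorem shiftMutual_le_of_compacts (hκ : IsKernel κ) {μ ν : PosRadon X} {b : ℝ≥0∞}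
    (h : ∀ K (hK : IsCompact K), shiftMutual κ c (μ.restrict K hK) (ν.restrict K hK) ≤ b) :
    shiftMutual κ c μ ν ≤ b :=
  lintegral_lintegral_kernel_le_of_compacts (hκ.lowerSemicontinuous_shiftKernel c) _ _ h

theorem posMutual_ne_bot (hκ : IsKernel κ) (hc : LowerBoundedBy κ c) (μ ν : PosRadon X) :
    posMutual κ μ ν ≠ ⊥ := by
  have h : (c * ν.toMeasure univ * μ.toMeasure univ : ℝ≥0∞) ≠ ⊤ := by
    by_cases h0 : c = 0
    · simp [h0]
    · have := hc.compact h0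
      exact ENNReal.mul_ne_top (hc.mul_univ_ne_top ν) isCompact_univ.measure_lt_top.ne
  rw [posMutual_eq hκ hc]
  lift (c * ν.toMeasure univ * μ.toMeasure univ : ℝ≥0∞) to ℝ≥0 using h with d
  induction shiftMutual κ c μ ν with
  | top => simp [EReal.coe_nnreal_eq_coe_real]
  | coe z => simp only [EReal.coe_nnreal_eq_coe_real, ← EReal.coe_sub]; exact EReal.coe_ne_bot _

theorem posMutual_eq_top_iff (hκ : IsKernel κ) (hc : LowerBoundedBy κ c) (μ ν : PosRadon X) :
    posMutual κ μ ν = ⊤ ↔ shiftMutual κ c μ ν = ⊤ := by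
  have h : (c * ν.toMeasure univ * μ.toMeasure univ : ℝ≥0∞) ≠ ⊤ := by
    by_cases h0 : c = 0
    · simp [h0]
    · have := hc.compact h0
      exact ENNReal.mul_ne_top (hc.mul_univ_ne_top ν) isCompact_univ.measure_lt_top.ne
  rw [posMutual_eq hκ hc]
  lift (c * ν.toMeasure univ * μ.toMeasure univ : ℝ≥0∞) to ℝ≥0 using h with d
  induction shiftMutual κ c μ ν with
  | top => simp [EReal.coe_nnreal_eq_coe_real]
  | coe z =>
    simp only [EReal.coe_nnreal_eq_coe_real, ← EReal.coe_sub, ENNReal.coe_ne_top, iff_false]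
    exact EReal.coe_ne_top _

end Mutual

/-! ### The energy form on `ℰ⁺` -/

/-- A positive definite kernel, bounded below by `-c`. -/
structure PosDefKernel {X : Type*} [TopologicalSpace X] [MeasurableSpace X]
    (κ : X → X → EReal) (c : ℝ≥0) : Prop where
  isKernel : IsKernel κ
  posDef : IsPosDef κ
  bound : LowerBoundedBy κ c

/-- The mutual energy of two elements of `ℰ⁺` as a real number. -/
noncomputable def mutualReal {X : Type*} [TopologicalSpace X] [MeasurableSpace X]
    (κ : X → X → EReal) (μ ν : PosRadon X) : ℝ := (posMutual κ μ ν).toReal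

namespace PosDefKernel

variable {X : Type*} [TopologicalSpace X] [T2Space X] [LocallyCompactSpace X] [MeasurableSpace X]
  [BorelSpace X] {κ : X → X → EReal} {c : ℝ≥0}

theorem isFiniteMeasure (h : PosDefKernel κ c) (h0 : c ≠ 0) (μ : PosRadon X) :
    IsFiniteMeasure μ.toMeasure := by
  have := h.bound.compact h0
  exact ⟨isCompact_univ.measure_lt_top⟩

theorem mem_finiteEnergyPlus_iff (h : PosDefKernel κ c) (μ : PosRadon X) :
    μ ∈ FiniteEnergyPlus κ ↔ shiftMutual κ c μ μ ≠ ⊤ := by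
  have h1 : μ ∈ FiniteEnergyPlus κ ↔ posMutual κ μ μ ≠ ⊥ ∧ posMutual κ μ μ ≠ ⊤ := by
    rw [← mutualEnergy_toRadon]; rfl
  rw [h1, ne_eq, ne_eq, posMutual_eq_top_iff h.isKernel h.bound]
  exact and_iff_right (posMutual_ne_bot h.isKernel h.bound μ μ)

theorem coe_mutualReal' (h : PosDefKernel κ c) {μ ν : PosRadon X}
    (hfin : shiftMutual κ c μ ν ≠ ⊤) : posMutual κ μ ν = (mutualReal κ μ ν : EReal) :=
  (EReal.coe_toReal (by rwa [ne_eq, posMutual_eq_top_iff h.isKernel h.bound])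
    (posMutual_ne_bot h.isKernel h.bound μ ν)).symm

theorem mutualReal_eq (h : PosDefKernel κ c) {μ ν : PosRadon X}
    (hfin : shiftMutual κ c μ ν ≠ ⊤) : mutualReal κ μ ν = (shiftMutual κ c μ ν).toReal -
      c * (ν.toMeasure univ).toReal * (μ.toMeasure univ).toReal := by
  rw [mutualReal, posMutual_eq h.isKernel h.bound, EReal.toReal_sub]
  · simp only [EReal.toReal_coe_ennreal, ENNReal.toReal_mul, ENNReal.coe_toReal]
  · exact EReal.coe_ennreal_eq_top_iff.not.2 hfin
  · exact EReal.coe_ennreal_ne_bot _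
  · refine EReal.coe_ennreal_eq_top_iff.not.2 ?_
    by_cases h0 : c = 0
    · simp [h0]
    · have := h.isFiniteMeasure h0
      exact ENNReal.mul_ne_top (h.bound.mul_univ_ne_top ν) (measure_ne_top _ _)
  · exact EReal.coe_ennreal_ne_bot _

theorem shiftMutual_comm (h : PosDefKernel κ c) (μ ν : PosRadon X) :
    shiftMutual κ c μ ν = shiftMutual κ c ν μ :=
  CondenserEnergy.shiftMutual_comm h.isKernel h.posDef.1 μ ν

theorem shiftMutual_add_right (h : PosDefKernel κ c) (μ ν ν' : PosRadon X) :
    shiftMutual κ c μ (ν + ν') = shiftMutual κ c μ ν + shiftMutual κ c μ ν' := by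
  rw [h.shiftMutual_comm, shiftMutual_add_left, h.shiftMutual_comm ν, h.shiftMutual_comm ν']

theorem mutualReal_comm (h : PosDefKernel κ c) (μ ν : PosRadon X) :
    mutualReal κ μ ν = mutualReal κ ν μ := by
  rw [mutualReal, mutualReal, posMutual_eq h.isKernel h.bound, posMutual_eq h.isKernel h.bound,
    h.shiftMutual_comm, mul_right_comm]

theorem mutualReal_add_left' (h : PosDefKernel κ c) {μ μ' ν : PosRadon X}
    (hμ : shiftMutual κ c μ ν ≠ ⊤) (hμ' : shiftMutual κ c μ' ν ≠ ⊤) :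
    mutualReal κ (μ + μ') ν = mutualReal κ μ ν + mutualReal κ μ' ν := by
  have hsum : shiftMutual κ c (μ + μ') ν ≠ ⊤ := by
    rw [shiftMutual_add_left]; exact ENNReal.add_ne_top.2 ⟨hμ, hμ'⟩
  rw [h.mutualReal_eq hμ, h.mutualReal_eq hμ', h.mutualReal_eq hsum, shiftMutual_add_left,
    ENNReal.toReal_add hμ hμ']
  by_cases h0 : c = 0
  · simp [h0]
  · have := h.isFiniteMeasure h0
    rw [PosRadon.add_toMeasure, Measure.add_apply,
      ENNReal.toReal_add (measure_ne_top _ _) (measure_ne_top _ _)]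
    ring

theorem mutualReal_smul_left' (h : PosDefKernel κ c) (t : ℝ≥0) {μ ν : PosRadon X}
    (hμ : shiftMutual κ c μ ν ≠ ⊤) : mutualReal κ (t • μ) ν = t * mutualReal κ μ ν := by
  have hsum : shiftMutual κ c (t • μ) ν ≠ ⊤ := by
    rw [shiftMutual_smul_left]; exact ENNReal.mul_ne_top ENNReal.coe_ne_top hμ
  rw [h.mutualReal_eq hμ, h.mutualReal_eq hsum, shiftMutual_smul_left]
  simp only [ENNReal.toReal_mul, ENNReal.coe_toReal, PosRadon.smul_toMeasure, Measure.smul_apply,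
    ENNReal.smul_def, smul_eq_mul]
  ring

theorem mutualReal_add_right' (h : PosDefKernel κ c) {μ ν ν' : PosRadon X}
    (hν : shiftMutual κ c μ ν ≠ ⊤) (hν' : shiftMutual κ c μ ν' ≠ ⊤) :
    mutualReal κ μ (ν + ν') = mutualReal κ μ ν + mutualReal κ μ ν' := by
  rw [h.shiftMutual_comm] at hν hν'
  rw [h.mutualReal_comm, h.mutualReal_add_left' hν hν', h.mutualReal_comm ν, h.mutualReal_comm ν']

/-- Positive definiteness concerns Jordan decompositions only, so the common part of `μ` and `ν` is
split off first; it cancels in the energy of `μ - ν`. -/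
theorem nonneg_of_finite (h : PosDefKernel κ c) {μ ν : PosRadon X} [IsFiniteMeasure μ.toMeasure]
    [IsFiniteMeasure ν.toMeasure] (hμ : shiftMutual κ c μ μ ≠ ⊤) (hν : shiftMutual κ c ν ν ≠ ⊤) :
    shiftMutual κ c μ ν ≠ ⊤ ∧
      0 ≤ mutualReal κ μ μ + mutualReal κ ν ν - 2 * mutualReal κ μ ν := by
  obtain ⟨ρ, p, n, rfl, rfl, hpn⟩ := exists_common_part μ ν
  have hρμ : ρ.toMeasure ≤ (ρ + p).toMeasure := Measure.le_add_right le_rfl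
  have hpμ : p.toMeasure ≤ (ρ + p).toMeasure := Measure.le_add_left le_rfl
  have hρν : ρ.toMeasure ≤ (ρ + n).toMeasure := Measure.le_add_right le_rfl
  have hnν : n.toMeasure ≤ (ρ + n).toMeasure := Measure.le_add_left le_rfl
  have hρρ : shiftMutual κ c ρ ρ ≠ ⊤ := ne_top_of_le_ne_top hμ (shiftMutual_mono hρμ hρμ)
  have hpp : shiftMutual κ c p p ≠ ⊤ := ne_top_of_le_ne_top hμ (shiftMutual_mono hpμ hpμ)
  have hnn : shiftMutual κ c n n ≠ ⊤ := ne_top_of_le_ne_top hν (shiftMutual_mono hnν hnν)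
  have hρp : shiftMutual κ c ρ p ≠ ⊤ := ne_top_of_le_ne_top hμ (shiftMutual_mono hρμ hpμ)
  have hρn : shiftMutual κ c ρ n ≠ ⊤ := ne_top_of_le_ne_top hν (shiftMutual_mono hρν hnν)
  have hpρ : shiftMutual κ c p ρ ≠ ⊤ := by rwa [h.shiftMutual_comm]
  have hnρ : shiftMutual κ c n ρ ≠ ⊤ := by rwa [h.shiftMutual_comm]
  let σ : Radon X := ⟨p, n, fun K _ => hpn.mono Measure.restrict_le_self Measure.restrict_le_self⟩
  have hpos : mutualPos κ σ σ = ((mutualReal κ p p + mutualReal κ n n : ℝ) : EReal) := by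
    rw [EReal.coe_add, ← h.coe_mutualReal' hpp, ← h.coe_mutualReal' hnn]; rfl
  have hdef : MutualDefined κ σ σ := fun hd => by
    rw [hpos] at hd
    exact EReal.coe_ne_top _ hd.1
  have h0 := h.posDef.2 σ hdef
  -- The positive part of the energy of `σ` is finite. An infinite `κ(p, n)` would make this energy
  -- well defined and equal to `-∞`.
  have hpn' : shiftMutual κ c p n ≠ ⊤ := fun htop => by
    have h1 : posMutual κ p n = ⊤ := (posMutual_eq_top_iff h.isKernel h.bound _ _).2 htop
    have h2 : mutualNeg κ σ σ = ⊤ := by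
      change posMutual κ p n + posMutual κ n p = ⊤
      rw [h1, EReal.top_add_of_ne_bot (posMutual_ne_bot h.isKernel h.bound _ _)]
    rw [mutualEnergy, h2, EReal.sub_top] at h0
    exact absurd h0 (by simp)
  have hnp' : shiftMutual κ c n p ≠ ⊤ := by rwa [h.shiftMutual_comm]
  have hneg : mutualNeg κ σ σ = ((mutualReal κ p n + mutualReal κ n p : ℝ) : EReal) := by
    rw [EReal.coe_add, ← h.coe_mutualReal' hpn', ← h.coe_mutualReal' hnp']; rfl
  rw [mutualEnergy, hpos, hneg, ← EReal.coe_sub, EReal.coe_nonneg, h.mutualReal_comm n p] at h0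
  have hρ_n : shiftMutual κ c ρ (ρ + n) ≠ ⊤ := by
    rw [h.shiftMutual_add_right]; exact ENNReal.add_ne_top.2 ⟨hρρ, hρn⟩
  have hp_n : shiftMutual κ c p (ρ + n) ≠ ⊤ := by
    rw [h.shiftMutual_add_right]; exact ENNReal.add_ne_top.2 ⟨hpρ, hpn'⟩
  have hρ_p : shiftMutual κ c ρ (ρ + p) ≠ ⊤ := by
    rw [h.shiftMutual_add_right]; exact ENNReal.add_ne_top.2 ⟨hρρ, hρp⟩
  have hp_p : shiftMutual κ c p (ρ + p) ≠ ⊤ := by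
    rw [h.shiftMutual_add_right]; exact ENNReal.add_ne_top.2 ⟨hpρ, hpp⟩
  have hn_n : shiftMutual κ c n (ρ + n) ≠ ⊤ := by
    rw [h.shiftMutual_add_right]; exact ENNReal.add_ne_top.2 ⟨hnρ, hnn⟩
  refine ⟨by rw [shiftMutual_add_left]; exact ENNReal.add_ne_top.2 ⟨hρ_n, hp_n⟩, ?_⟩
  rw [h.mutualReal_add_left' hρ_n hp_n, h.mutualReal_add_left' hρ_p hp_p,
    h.mutualReal_add_left' hρ_n hn_n, h.mutualReal_add_right' hρρ hρn,
    h.mutualReal_add_right' hpρ hpn', h.mutualReal_add_right' hρρ hρp,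
    h.mutualReal_add_right' hpρ hpp, h.mutualReal_add_right' hnρ hnn,
    h.mutualReal_comm n ρ, h.mutualReal_comm p ρ]
  linarith

/-- For `c ≠ 0` all measures are finite. For `c = 0` the finite case is applied to restrictions to
compact sets, where it bounds the mutual energy by half the sum of the two energies, uniformly in
the compact set. -/
theorem nonneg_aux (h : PosDefKernel κ c) {μ ν : PosRadon X}
    (hμ : shiftMutual κ c μ μ ≠ ⊤) (hν : shiftMutual κ c ν ν ≠ ⊤) :
    shiftMutual κ c μ ν ≠ ⊤ ∧
      0 ≤ mutualReal κ μ μ + mutualReal κ ν ν - 2 * mutualReal κ μ ν := by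
  by_cases h0 : c = 0
  · subst h0
    have hle : shiftMutual κ 0 μ ν ≤ (shiftMutual κ 0 μ μ + shiftMutual κ 0 ν ν) / 2 := by
      refine shiftMutual_le_of_compacts h.isKernel fun K hK => ?_
      have hμK : shiftMutual κ 0 (μ.restrict K hK) (μ.restrict K hK) ≤ shiftMutual κ 0 μ μ :=
        shiftMutual_mono Measure.restrict_le_self Measure.restrict_le_self
      have hνK : shiftMutual κ 0 (ν.restrict K hK) (ν.restrict K hK) ≤ shiftMutual κ 0 ν ν :=
        shiftMutual_mono Measure.restrict_le_self Measure.restrict_le_self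
      have h1 := ne_top_of_le_ne_top hμ hμK
      have h2 := ne_top_of_le_ne_top hν hνK
      have : IsFiniteMeasure (μ.restrict K hK).toMeasure := ⟨by simpa using hK.measure_lt_top⟩
      have : IsFiniteMeasure (ν.restrict K hK).toMeasure := ⟨by simpa using hK.measure_lt_top⟩
      obtain ⟨h3, h4⟩ := h.nonneg_of_finite h1 h2
      refine le_trans ?_ (ENNReal.div_le_div_right (add_le_add hμK hνK) 2)
      rw [h.mutualReal_eq h1, h.mutualReal_eq h2, h.mutualReal_eq h3] at h4
      rw [ENNReal.le_div_iff_mul_le (by simp) (by simp),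
        ← ENNReal.toReal_le_toReal (ENNReal.mul_ne_top h3 (by simp)) (ENNReal.add_ne_top.2 ⟨h1, h2⟩),
        ENNReal.toReal_mul, ENNReal.toReal_add h1 h2]
      simp only [NNReal.coe_zero, zero_mul, sub_zero] at h4
      simp only [ENNReal.toReal_ofNat]
      linarith
    have hne : (shiftMutual κ 0 μ μ + shiftMutual κ 0 ν ν) / 2 ≠ ⊤ :=
      ENNReal.div_ne_top (ENNReal.add_ne_top.2 ⟨hμ, hν⟩) (by simp)
    have hfin := ne_top_of_le_ne_top hne hle
    refine ⟨hfin, ?_⟩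
    rw [← ENNReal.toReal_le_toReal hfin hne, ENNReal.toReal_div, ENNReal.toReal_add hμ hν] at hle
    rw [h.mutualReal_eq hμ, h.mutualReal_eq hν, h.mutualReal_eq hfin]
    simp only [NNReal.coe_zero, zero_mul, sub_zero]
    simp only [ENNReal.toReal_ofNat] at hle
    linarith
  · have := h.isFiniteMeasure h0
    exact h.nonneg_of_finite hμ hν

section Form

variable {μ μ' ν ν' : PosRadon X}

theorem shiftMutual_ne_top (h : PosDefKernel κ c) (hμ : μ ∈ FiniteEnergyPlus κ)
    (hν : ν ∈ FiniteEnergyPlus κ) : shiftMutual κ c μ ν ≠ ⊤ :=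
  (h.nonneg_aux ((h.mem_finiteEnergyPlus_iff μ).1 hμ) ((h.mem_finiteEnergyPlus_iff ν).1 hν)).1

/-- Positivity of the energy of a difference. -/
theorem nonneg_sub (h : PosDefKernel κ c) (hμ : μ ∈ FiniteEnergyPlus κ)
    (hν : ν ∈ FiniteEnergyPlus κ) :
    0 ≤ mutualReal κ μ μ + mutualReal κ ν ν - 2 * mutualReal κ μ ν :=
  (h.nonneg_aux ((h.mem_finiteEnergyPlus_iff μ).1 hμ) ((h.mem_finiteEnergyPlus_iff ν).1 hν)).2

theorem coe_mutualReal (h : PosDefKernel κ c) (hμ : μ ∈ FiniteEnergyPlus κ)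
    (hν : ν ∈ FiniteEnergyPlus κ) : posMutual κ μ ν = (mutualReal κ μ ν : EReal) :=
  h.coe_mutualReal' (h.shiftMutual_ne_top hμ hν)

theorem add_mem (h : PosDefKernel κ c) (hμ : μ ∈ FiniteEnergyPlus κ)
    (hν : ν ∈ FiniteEnergyPlus κ) : μ + ν ∈ FiniteEnergyPlus κ := by
  rw [h.mem_finiteEnergyPlus_iff, shiftMutual_add_left, h.shiftMutual_add_right,
    h.shiftMutual_add_right]
  simp [h.shiftMutual_ne_top, hμ, hν]

theorem smul_mem (h : PosDefKernel κ c) (t : ℝ≥0) (hμ : μ ∈ FiniteEnergyPlus κ) :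
    t • μ ∈ FiniteEnergyPlus κ := by
  rw [h.mem_finiteEnergyPlus_iff, shiftMutual_smul_left, h.shiftMutual_comm,
    shiftMutual_smul_left]
  exact ENNReal.mul_ne_top ENNReal.coe_ne_top
    (ENNReal.mul_ne_top ENNReal.coe_ne_top (h.shiftMutual_ne_top hμ hμ))

theorem zero_mem (h : PosDefKernel κ c) : (0 : PosRadon X) ∈ FiniteEnergyPlus κ := by
  rw [h.mem_finiteEnergyPlus_iff]; simp [shiftMutual]

theorem mutualReal_add_left (h : PosDefKernel κ c) (hμ : μ ∈ FiniteEnergyPlus κ)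
    (hμ' : μ' ∈ FiniteEnergyPlus κ) (hν : ν ∈ FiniteEnergyPlus κ) :
    mutualReal κ (μ + μ') ν = mutualReal κ μ ν + mutualReal κ μ' ν :=
  h.mutualReal_add_left' (h.shiftMutual_ne_top hμ hν) (h.shiftMutual_ne_top hμ' hν)

theorem mutualReal_add_right (h : PosDefKernel κ c) (hμ : μ ∈ FiniteEnergyPlus κ)
    (hν : ν ∈ FiniteEnergyPlus κ) (hν' : ν' ∈ FiniteEnergyPlus κ) :
    mutualReal κ μ (ν + ν') = mutualReal κ μ ν + mutualReal κ μ ν' :=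
  h.mutualReal_add_right' (h.shiftMutual_ne_top hμ hν) (h.shiftMutual_ne_top hμ hν')

theorem mutualReal_smul_left (h : PosDefKernel κ c) (t : ℝ≥0) (hμ : μ ∈ FiniteEnergyPlus κ)
    (hν : ν ∈ FiniteEnergyPlus κ) : mutualReal κ (t • μ) ν = t * mutualReal κ μ ν :=
  h.mutualReal_smul_left' t (h.shiftMutual_ne_top hμ hν)

theorem mutualReal_smul_right (h : PosDefKernel κ c) (t : ℝ≥0) (hμ : μ ∈ FiniteEnergyPlus κ)
    (hν : ν ∈ FiniteEnergyPlus κ) : mutualReal κ μ (t • ν) = t * mutualReal κ μ ν := by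
  rw [h.mutualReal_comm, h.mutualReal_smul_left t hν hμ, h.mutualReal_comm]

theorem mutualReal_zero_left (h : PosDefKernel κ c) (ν : PosRadon X) :
    mutualReal κ 0 ν = 0 := by
  rw [h.mutualReal_eq (by simp [shiftMutual])]; simp [shiftMutual]

theorem mutualReal_self_nonneg (h : PosDefKernel κ c) (hμ : μ ∈ FiniteEnergyPlus κ) :
    0 ≤ mutualReal κ μ μ := by
  simpa [h.mutualReal_zero_left, h.mutualReal_comm μ 0] using h.nonneg_sub hμ h.zero_mem

theorem abs_mutualReal_le (h : PosDefKernel κ c) (hμ : μ ∈ FiniteEnergyPlus κ)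
    (hν : ν ∈ FiniteEnergyPlus κ) :
    2 * |mutualReal κ μ ν| ≤ mutualReal κ μ μ + mutualReal κ ν ν := by
  have h1 := h.nonneg_sub hμ hν
  have h2 := h.mutualReal_self_nonneg (h.add_mem hμ hν)
  rw [h.mutualReal_add_left hμ hν (h.add_mem hμ hν), h.mutualReal_add_right hμ hμ hν,
    h.mutualReal_add_right hν hμ hν, h.mutualReal_comm ν μ] at h2
  rcases abs_cases (mutualReal κ μ ν) with ⟨h3, -⟩ | ⟨h3, -⟩ <;> rw [h3] <;> linarith

/-- A form of the Cauchy–Schwarz inequality for `κ(μ - ν, ρ)`. -/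
theorem abs_mutualReal_sub_le (h : PosDefKernel κ c) {ρ : PosRadon X}
    (hμ : μ ∈ FiniteEnergyPlus κ) (hν : ν ∈ FiniteEnergyPlus κ) (hρ : ρ ∈ FiniteEnergyPlus κ)
    (t : ℝ≥0) : 2 * t * |mutualReal κ μ ρ - mutualReal κ ν ρ| ≤
      (mutualReal κ μ μ + mutualReal κ ν ν - 2 * mutualReal κ μ ν) +
        t ^ 2 * mutualReal κ ρ ρ := by
  have key : ∀ μ ν : PosRadon X, μ ∈ FiniteEnergyPlus κ → ν ∈ FiniteEnergyPlus κ →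
      2 * t * (mutualReal κ μ ρ - mutualReal κ ν ρ) ≤
      (mutualReal κ μ μ + mutualReal κ ν ν - 2 * mutualReal κ μ ν) +
        t ^ 2 * mutualReal κ ρ ρ := by
    intro μ ν hμ hν
    have hs := h.smul_mem t hρ
    have hsum := h.add_mem hν hs
    -- This is the expansion of `‖μ - (ν + tρ)‖² ≥ 0`. Exchanging `μ` and `ν` then gives the
    -- absolute value.
    have h1 := h.nonneg_sub hμ hsum
    rw [h.mutualReal_add_left hν hs hsum, h.mutualReal_add_right hν hν hs,
      h.mutualReal_add_right hs hν hs, h.mutualReal_add_right hμ hν hs,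
      h.mutualReal_smul_right t hμ hρ, h.mutualReal_smul_right t hν hρ,
      h.mutualReal_smul_left t hρ hν, h.mutualReal_smul_left t hρ hs,
      h.mutualReal_smul_right t hρ hρ, h.mutualReal_comm ρ ν] at h1
    nlinarith
  rcases abs_cases (mutualReal κ μ ρ - mutualReal κ ν ρ) with ⟨h3, -⟩ | ⟨h3, -⟩ <;> rw [h3]
  · exact key μ ν hμ hν
  · have := key ν μ hν hμ
    rw [h.mutualReal_comm ν μ] at this
    linarith

theorem normSubSq_eq (μ ν : PosRadon X) : normSubSq κ μ.toRadon ν.toRadon =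
    mutualReal κ μ μ + mutualReal κ ν ν - 2 * mutualReal κ μ ν := by
  simp [normSubSq, mutualEnergy_toRadon, mutualReal]

end Form

end PosDefKernel

/-! ### Consistency -/

section Consistency

variable {X : Type*} [TopologicalSpace X] [T2Space X] [LocallyCompactSpace X] [MeasurableSpace X]
  [BorelSpace X] {κ : X → X → EReal} {c : ℝ≥0}

theorem tendsto_posRadon_iff {α : Type*} {l : Filter α} {f : α → PosRadon X} {μ : PosRadon X} :
    Tendsto f l (𝓝 μ) ↔ ∀ φ : C_c(X, ℝ),
      Tendsto (fun a => ∫ x, φ x ∂(f a).toMeasure) l (𝓝 (∫ x, φ x ∂μ.toMeasure)) := by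
  rw [nhds_induced, tendsto_comap_iff, tendsto_pi_nhds]
  rfl

/-- The conclusion of property (C₂), tested on `ℰ⁺` only. -/
def WeaklyConsistent (κ : X → X → EReal) : Prop :=
  ∀ F : Filter (PosRadon X), F.NeBot → FiniteEnergyPlus κ ∈ F →
    (∃ C : ℝ, ∀ᶠ μ in F, mutualReal κ μ μ ≤ C) →
    ∀ μ₀ : PosRadon X, F ≤ 𝓝 μ₀ → μ₀ ∈ FiniteEnergyPlus κ ∧
      ∀ ν ∈ FiniteEnergyPlus κ,
        Tendsto (fun μ => mutualReal κ μ ν) F (𝓝 (mutualReal κ μ₀ ν))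

theorem PropertyC2.weaklyConsistent (h : PosDefKernel κ c) (h2 : PropertyC2 κ) :
    WeaklyConsistent κ := by
  rintro F hF hmem ⟨C, hC⟩ μ₀ hμ₀
  obtain ⟨h3, h4⟩ := h2 F hF hmem ⟨C, by
    filter_upwards [hC, hmem] with μ hμ hμ'
    rw [mutualEnergy_toRadon, h.coe_mutualReal hμ' hμ']
    exact_mod_cast hμ⟩ μ₀ hμ₀
  refine ⟨h3, fun ν hν => ?_⟩
  simpa only [mutualEnergy_toRadon, mutualReal] using h4 ν.toRadon hν

/-- A set of measures closed under the formation of midpoints. -/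
def MidpointClosed (P : Set (PosRadon X)) : Prop :=
  ∀ μ ∈ P, ∀ ν ∈ P, (2⁻¹ : ℝ≥0) • (μ + ν) ∈ P

theorem MidpointClosed.inter {P Q : Set (PosRadon X)} (hP : MidpointClosed P)
    (hQ : MidpointClosed Q) : MidpointClosed (P ∩ Q) := fun μ hμ ν hν =>
  ⟨hP μ hμ.1 ν hν.1, hQ μ hμ.2 ν hν.2⟩

theorem PosDefKernel.midpointClosed_finiteEnergyPlus (h : PosDefKernel κ c) :
    MidpointClosed (FiniteEnergyPlus κ) := fun _ hμ _ hν => h.smul_mem _ (h.add_mem hμ hν)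

theorem PosDefKernel.mutualReal_midpoint_left (h : PosDefKernel κ c) {μ ν ρ : PosRadon X}
    (hμ : μ ∈ FiniteEnergyPlus κ) (hν : ν ∈ FiniteEnergyPlus κ) (hρ : ρ ∈ FiniteEnergyPlus κ) :
    mutualReal κ ((2⁻¹ : ℝ≥0) • (μ + ν)) ρ = (mutualReal κ μ ρ + mutualReal κ ν ρ) / 2 := by
  rw [h.mutualReal_smul_left _ (h.add_mem hμ hν) hρ, h.mutualReal_add_left hμ hν hρ,
    NNReal.coe_inv, NNReal.coe_ofNat]
  ring

theorem PosDefKernel.mutualReal_midpoint_self (h : PosDefKernel κ c) {μ ν : PosRadon X}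
    (hμ : μ ∈ FiniteEnergyPlus κ) (hν : ν ∈ FiniteEnergyPlus κ) :
    4 * mutualReal κ ((2⁻¹ : ℝ≥0) • (μ + ν)) ((2⁻¹ : ℝ≥0) • (μ + ν)) =
      mutualReal κ μ μ + mutualReal κ ν ν + 2 * mutualReal κ μ ν := by
  have hm := h.midpointClosed_finiteEnergyPlus μ hμ ν hν
  rw [h.mutualReal_midpoint_left hμ hν hm, h.mutualReal_comm μ, h.mutualReal_comm ν,
    h.mutualReal_midpoint_left hμ hν hμ, h.mutualReal_midpoint_left hμ hν hν,
    h.mutualReal_comm ν μ]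
  ring

theorem integral_midpoint (μ ν : PosRadon X) (φ : C_c(X, ℝ)) :
    ∫ x, φ x ∂((2⁻¹ : ℝ≥0) • (μ + ν)).toMeasure =
      (∫ x, φ x ∂μ.toMeasure + ∫ x, φ x ∂ν.toMeasure) / 2 := by
  rw [PosRadon.smul_toMeasure, integral_smul_nnreal_measure, PosRadon.add_toMeasure,
    integral_add_measure φ.integrable φ.integrable, NNReal.smul_def, smul_eq_mul, NNReal.coe_inv,
    NNReal.coe_ofNat]
  ring

/-- The elements of nearly minimal energy in midpoint closed members of an energy bounded
ultrafilter form a strong Cauchy filter. -/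
theorem PosDefKernel.exists_cauchy_filter (h : PosDefKernel κ c) (U : Ultrafilter (PosRadon X))
    (hU : FiniteEnergyPlus κ ∈ U) {C : ℝ} (hC : ∀ᶠ μ in (U : Filter (PosRadon X)),
      mutualReal κ μ μ ≤ C) :
    ∃ G : Filter (PosRadon X), G.NeBot ∧ (∀ P, MidpointClosed P → P ∈ U → P ∈ G) ∧
      ∀ ε : ℝ, 0 < ε → ∃ S ∈ G, ∀ μ ∈ S, ∀ ν ∈ S, normSubSq κ μ.toRadon ν.toRadon < ε := by
  let N : PosRadon X → ℝ := fun μ => mutualReal κ μ μ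
  let T : Set (PosRadon X) := {μ | μ ∈ FiniteEnergyPlus κ ∧ N μ ≤ C}
  have hT : T ∈ U := inter_mem hU hC
  have hTmid : MidpointClosed T := fun μ hμ ν hν => by
    refine ⟨h.midpointClosed_finiteEnergyPlus μ hμ.1 ν hν.1, ?_⟩
    have h1 := h.mutualReal_midpoint_self hμ.1 hν.1
    have h2 := h.nonneg_sub hμ.1 hν.1
    have h3 : mutualReal κ μ μ ≤ C := hμ.2
    have h4 : mutualReal κ ν ν ≤ C := hν.2
    change mutualReal κ _ _ ≤ C
    linarith
  let 𝔓 : Set (Set (PosRadon X)) := {P | MidpointClosed P ∧ P ∈ U ∧ P ⊆ T}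
  have hTP : T ∈ 𝔓 := ⟨hTmid, hT, Subset.rfl⟩
  have hinter : ∀ P ∈ 𝔓, ∀ Q ∈ 𝔓, P ∩ Q ∈ 𝔓 := fun P hP Q hQ =>
    ⟨hP.1.inter hQ.1, inter_mem hP.2.1 hQ.2.1, inter_subset_left.trans hP.2.2⟩
  have hbdd : ∀ P ∈ 𝔓, BddBelow (N '' P) := fun P hP =>
    ⟨0, by rintro _ ⟨μ, hμ, rfl⟩; exact h.mutualReal_self_nonneg (hP.2.2 hμ).1⟩
  have hne : ∀ P ∈ 𝔓, P.Nonempty := fun P hP => U.nonempty_of_mem hP.2.1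
  have hbdd' : BddAbove ((fun P => sInf (N '' P)) '' 𝔓) := by
    refine ⟨C, ?_⟩
    rintro _ ⟨P, hP, rfl⟩
    obtain ⟨μ, hμ⟩ := hne P hP
    exact (csInf_le (hbdd P hP) ⟨μ, hμ, rfl⟩).trans (hP.2.2 hμ).2
  -- The infimum of the energy over `P` grows as `P` shrinks, and `d` is its supremum. Since no
  -- infimum exceeds `d`, the sets `V P ε` are nonempty, and they generate the filter.
  let d : ℝ := sSup ((fun P => sInf (N '' P)) '' 𝔓)
  let V : Set (PosRadon X) → ℝ → Set (PosRadon X) := fun P ε => {μ ∈ P | N μ < d + ε}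
  let G : Filter (PosRadon X) :=
    { sets := {W | ∃ P ∈ 𝔓, ∃ ε : ℝ, 0 < ε ∧ V P ε ⊆ W}
      univ_sets := ⟨T, hTP, 1, one_pos, subset_univ _⟩
      sets_of_superset := by
        rintro W W' ⟨P, hP, ε, hε, hV⟩ hW
        exact ⟨P, hP, ε, hε, hV.trans hW⟩
      inter_sets := by
        rintro W W' ⟨P, hP, ε, hε, hV⟩ ⟨P', hP', ε', hε', hV'⟩
        refine ⟨P ∩ P', hinter P hP P' hP', min ε ε', lt_min hε hε', fun μ hμ => ⟨?_, ?_⟩⟩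
        · exact hV ⟨hμ.1.1, hμ.2.trans_le (by gcongr; exact min_le_left _ _)⟩
        · exact hV' ⟨hμ.1.2, hμ.2.trans_le (by gcongr; exact min_le_right _ _)⟩ }
  refine ⟨G, ⟨fun hbot => ?_⟩, fun P hP hPU => ?_, fun ε hε => ?_⟩
  · have : (∅ : Set (PosRadon X)) ∈ G := hbot ▸ mem_bot
    obtain ⟨P, hP, ε, hε, hV⟩ := this
    have h1 : sInf (N '' P) < d + ε :=
      (le_csSup hbdd' ⟨P, hP, rfl⟩).trans_lt (lt_add_of_pos_right d hε)
    obtain ⟨_, ⟨μ, hμ, rfl⟩, hlt⟩ := exists_lt_of_csInf_lt ((hne P hP).image N) h1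
    have hmem : μ ∈ (∅ : Set (PosRadon X)) := hV ⟨hμ, hlt⟩
    exact hmem
  · exact ⟨P ∩ T, ⟨hP.inter hTmid, inter_mem hPU hT, inter_subset_right⟩, 1, one_pos,
      fun μ hμ => hμ.1.1⟩
  -- Midpoints of elements of `V P (ε / 8)` stay in `P`, so their energy exceeds `d - ε / 8`. The
  -- parallelogram identity gives `‖μ - ν‖² < 4 (d + ε / 8) - 4 (d - ε / 8) = ε`.
  · have h1 : d - ε / 8 < d := by linarith
    obtain ⟨_, ⟨P, hP, rfl⟩, hlt⟩ := exists_lt_of_lt_csSup (Set.Nonempty.image _ ⟨T, hTP⟩) h1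
    refine ⟨V P (ε / 8), ⟨P, hP, ε / 8, by linarith, Subset.rfl⟩, fun μ hμ ν hν => ?_⟩
    have h2 := hlt.trans_le (csInf_le (hbdd P hP) ⟨_, hP.1 μ hμ.1 ν hν.1, rfl⟩)
    have h3 := h.mutualReal_midpoint_self (hP.2.2 hμ.1).1 (hP.2.2 hν.1).1
    have h4 : mutualReal κ μ μ < d + ε / 8 := hμ.2
    have h5 : mutualReal κ ν ν < d + ε / 8 := hν.2
    rw [PosDefKernel.normSubSq_eq]
    simp only [N] at h2
    linarith

theorem PosDefKernel.tendsto_mutualReal_of_normSubSq (h : PosDefKernel κ c)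
    {G : Filter (PosRadon X)} (hG : FiniteEnergyPlus κ ∈ G) {μ₀ ν : PosRadon X}
    (hμ₀ : μ₀ ∈ FiniteEnergyPlus κ) (hν : ν ∈ FiniteEnergyPlus κ)
    (hlim : Tendsto (fun μ : PosRadon X => normSubSq κ μ.toRadon μ₀.toRadon) G (𝓝 0)) :
    Tendsto (fun μ => mutualReal κ μ ν) G (𝓝 (mutualReal κ μ₀ ν)) := by
  rw [Metric.tendsto_nhds]
  intro ε hε
  have hN := h.mutualReal_self_nonneg hν
  -- With this `t` one has `t * ‖ν‖² ≤ ε`. Once `‖μ - μ₀‖² < t * ε`, the Cauchy–Schwarz form gives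
  -- `2 t |κ(μ - μ₀, ν)| < 2 t ε`.
  let t : ℝ≥0 := ⟨ε / (mutualReal κ ν ν + 1), by positivity⟩
  have ht : 0 < (t : ℝ) := by
    change 0 < ε / (mutualReal κ ν ν + 1)
    positivity
  have htN : (t : ℝ) * mutualReal κ ν ν ≤ ε := by
    change ε / (mutualReal κ ν ν + 1) * mutualReal κ ν ν ≤ ε
    rw [div_mul_eq_mul_div, div_le_iff₀ (by linarith)]
    nlinarith
  filter_upwards [hG, hlim.eventually (gt_mem_nhds (mul_pos ht hε))] with μ hμ hlt
  have h1 := h.abs_mutualReal_sub_le hμ hμ₀ hν t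
  rw [PosDefKernel.normSubSq_eq] at hlt
  rw [Real.dist_eq]
  by_contra hcon
  nlinarith [not_lt.1 hcon]

/-- A bounded ultrafilter need not be strongly Cauchy, but the associated filter of nearly minimal
elements is. It contains all midpoint closed members of the ultrafilter, so it inherits the vague
limit, and its limits of `κ(·, ν)` can be compared with those of the ultrafilter through
half-spaces. -/
theorem PropertyC1.weaklyConsistent (h : PosDefKernel κ c) (h1 : PropertyC1 κ) :
    WeaklyConsistent κ := by
  rintro F hF hmem ⟨C, hC⟩ μ₀ hμ₀
  have key : ∀ U : Ultrafilter (PosRadon X), (U : Filter (PosRadon X)) ≤ F →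
      μ₀ ∈ FiniteEnergyPlus κ ∧ ∀ ν ∈ FiniteEnergyPlus κ,
        Tendsto (fun μ => mutualReal κ μ ν) U (𝓝 (mutualReal κ μ₀ ν)) := by
    intro U hUF
    obtain ⟨G, hG, hGU, hcauchy⟩ := h.exists_cauchy_filter U (hUF hmem) (hUF hC)
    have hGE : FiniteEnergyPlus κ ∈ G := hGU _ h.midpointClosed_finiteEnergyPlus (hUF hmem)
    have hlim : G ≤ 𝓝 μ₀ := by
      rw [← tendsto_id', tendsto_posRadon_iff]
      intro φ
      have hU : Tendsto (fun μ : PosRadon X => ∫ x, φ x ∂μ.toMeasure) U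
        (𝓝 (∫ x, φ x ∂μ₀.toMeasure)) := tendsto_posRadon_iff.1 (tendsto_id'.2 (hUF.trans hμ₀)) φ
      rw [Metric.tendsto_nhds] at hU ⊢
      intro ε hε
      -- The condition that one integral lies within `ε` of its limit is preserved by midpoints.
      refine hGU _ (fun μ hμ ν hν => ?_) (hU ε hε)
      rw [mem_ofPred_eq, Real.dist_eq, abs_lt] at hμ hν ⊢
      simp only [id_eq] at hμ hν ⊢
      rw [integral_midpoint]
      constructor <;> linarith [hμ.1, hμ.2, hν.1, hν.2]
    obtain ⟨hμ₀E, hstrong⟩ := h1 G hG hGE hcauchy μ₀ (ClusterPt.of_le_nhds hlim)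
    refine ⟨hμ₀E, fun ν hν => ?_⟩
    have hGlim := h.tendsto_mutualReal_of_normSubSq hGE hμ₀E hν hstrong
    rw [tendsto_order] at hGlim ⊢
    refine ⟨fun b hb => ?_, fun b hb => ?_⟩
    -- Otherwise the half-space `{κ(·, ν) ≤ b}` belongs to the ultrafilter and, being midpoint
    -- closed, to `G`, against the strong limit of `G`.
    · by_contra hcon
      rw [← Ultrafilter.eventually_not] at hcon
      have hin : {μ | μ ∈ FiniteEnergyPlus κ ∧ mutualReal κ μ ν ≤ b} ∈ G := by
        refine hGU _ (fun μ hμ ρ hρ => ⟨h.midpointClosed_finiteEnergyPlus μ hμ.1 ρ hρ.1, ?_⟩) ?_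
        · rw [h.mutualReal_midpoint_left hμ.1 hρ.1 hν]
          linarith [hμ.2, hρ.2]
        · filter_upwards [hUF hmem, hcon] with μ h2 h3 using ⟨h2, not_lt.1 h3⟩
      obtain ⟨μ, h2, h3⟩ := ((hGlim.1 b hb).and hin).exists
      exact absurd h2 (not_lt.2 h3.2)
    · by_contra hcon
      rw [← Ultrafilter.eventually_not] at hcon
      have hin : {μ | μ ∈ FiniteEnergyPlus κ ∧ b ≤ mutualReal κ μ ν} ∈ G := by
        refine hGU _ (fun μ hμ ρ hρ => ⟨h.midpointClosed_finiteEnergyPlus μ hμ.1 ρ hρ.1, ?_⟩) ?_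
        · rw [h.mutualReal_midpoint_left hμ.1 hρ.1 hν]
          linarith [hμ.2, hρ.2]
        · filter_upwards [hUF hmem, hcon] with μ h2 h3 using ⟨h2, not_lt.1 h3⟩
      obtain ⟨μ, h2, h3⟩ := ((hGlim.2 b hb).and hin).exists
      exact absurd h2 (not_lt.2 h3.2)
  refine ⟨(key (Ultrafilter.of F) (Ultrafilter.of_le F)).1, fun ν hν => ?_⟩
  rw [tendsto_iff_ultrafilter]
  exact fun U hU => (key U hU).2 ν hν

theorem IsConsistent.weaklyConsistent (h : PosDefKernel κ c) (hcons : IsConsistent κ) :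
    WeaklyConsistent κ :=
  hcons.elim (PropertyC1.weaklyConsistent h) (PropertyC2.weaklyConsistent h)

end Consistency

/-! ### Interior capacity -/

/-- `μ` is a probability measure with compact support contained in `E`. -/
def IsUnitMeasureOn {X : Type*} [TopologicalSpace X] [MeasurableSpace X] (E : Set X)
    (μ : PosRadon X) : Prop :=
  μ.toMeasure univ = 1 ∧ ∃ K : Set X, IsCompact K ∧ K ⊆ E ∧ μ.toMeasure Kᶜ = 0

section Capacity

variable {X : Type*} [TopologicalSpace X] [T2Space X] [LocallyCompactSpace X] [MeasurableSpace X]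
  [BorelSpace X] {κ : X → X → EReal} {c : ℝ≥0}

theorem IsUnitMeasureOn.mono {E E' : Set X} (hE : E ⊆ E') {μ : PosRadon X}
    (h : IsUnitMeasureOn E μ) : IsUnitMeasureOn E' μ :=
  ⟨h.1, h.2.imp fun _ hK => ⟨hK.1, hK.2.1.trans hE, hK.2.2⟩⟩

theorem IsUnitMeasureOn.convex {E : Set X} {μ ν : PosRadon X} (hμ : IsUnitMeasureOn E μ)
    (hν : IsUnitMeasureOn E ν) {s t : ℝ≥0} (hst : s + t = 1) :
    IsUnitMeasureOn E (s • μ + t • ν) := by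
  obtain ⟨hμ1, K, hK, hKE, hμK⟩ := hμ
  obtain ⟨hν1, L, hL, hLE, hνL⟩ := hν
  refine ⟨?_, K ∪ L, hK.union hL, union_subset hKE hLE, ?_⟩
  · simp only [PosRadon.add_toMeasure, PosRadon.smul_toMeasure, Measure.add_apply,
      Measure.smul_apply, hμ1, hν1, ENNReal.smul_def, smul_eq_mul, mul_one]
    exact_mod_cast hst
  · have h1 : μ.toMeasure (K ∪ L)ᶜ = 0 :=
      measure_mono_null (compl_subset_compl.2 subset_union_left) hμK
    have h2 : ν.toMeasure (K ∪ L)ᶜ = 0 :=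
      measure_mono_null (compl_subset_compl.2 subset_union_right) hνL
    simp [-compl_union, h1, h2]

theorem interiorCapacity_mono {E E' : Set X} (hE : E ⊆ E') :
    interiorCapacity κ E ≤ interiorCapacity κ E' :=
  ENNReal.inv_le_inv.2 <| le_iInf₂ fun μ hμ => iInf₂_le μ (IsUnitMeasureOn.mono hE hμ)

namespace PosDefKernel

/-- An infinite positive part would make the energy either `⊤` or the undefined form, encoded as
`⊥`; membership in `ℰ` excludes both. -/
theorem pos_neg_mem (h : PosDefKernel κ c) {ω : Radon X} (hω : ω ∈ FiniteEnergy κ) :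
    ω.pos ∈ FiniteEnergyPlus κ ∧ ω.neg ∈ FiniteEnergyPlus κ := by
  have hb := fun μ ν => posMutual_ne_bot h.isKernel h.bound (κ := κ) μ ν
  have hpos : mutualPos κ ω ω ≠ ⊤ := fun htop => by
    obtain ⟨h1, h2⟩ := hω
    rw [mutualEnergy, htop] at h1 h2
    by_cases hneg : mutualNeg κ ω ω = ⊤
    · rw [hneg] at h1; exact h1 rfl
    · exact h2 (EReal.top_sub hneg)
  rw [h.mem_finiteEnergyPlus_iff, h.mem_finiteEnergyPlus_iff, ne_eq, ne_eq,
    ← posMutual_eq_top_iff h.isKernel h.bound, ← posMutual_eq_top_iff h.isKernel h.bound]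
  refine ⟨fun htop => hpos ?_, fun htop => hpos ?_⟩
  · rw [mutualPos, htop, EReal.top_add_of_ne_bot (hb _ _)]
  · rw [mutualPos, htop, EReal.add_top_of_ne_bot (hb _ _)]

theorem posMutual_eq_coe (h : PosDefKernel κ 0) (μ ν : PosRadon X) :
    posMutual κ μ ν = (shiftMutual κ 0 μ ν : EReal) := by
  rw [posMutual_eq h.isKernel h.bound]; simp

theorem toENNReal_energy (h : PosDefKernel κ 0) (μ : PosRadon X) :
    (mutualEnergy κ μ.toRadon μ.toRadon).toENNReal = shiftMutual κ 0 μ μ := by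
  rw [mutualEnergy_toRadon, h.posMutual_eq_coe, EReal.toENNReal_coe]

theorem mutualReal_eq_toReal (h : PosDefKernel κ 0) (μ ν : PosRadon X) :
    mutualReal κ μ ν = (shiftMutual κ 0 μ ν).toReal := by
  rw [mutualReal, h.posMutual_eq_coe, EReal.toReal_coe_ennreal]

theorem inv_interiorCapacity_le (h : PosDefKernel κ 0) {E : Set X} {μ : PosRadon X}
    (hμ : IsUnitMeasureOn E μ) :
    (interiorCapacity κ E)⁻¹ ≤ shiftMutual κ 0 μ μ := by
  rw [interiorCapacity, inv_inv, ← h.toENNReal_energy]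
  exact iInf₂_le μ hμ

theorem exists_unitMeasure_lt (h : PosDefKernel κ 0) {E : Set X} {b : ℝ≥0∞}
    (hb : (interiorCapacity κ E)⁻¹ < b) :
    ∃ μ, IsUnitMeasureOn E μ ∧ shiftMutual κ 0 μ μ < b := by
  rw [interiorCapacity, inv_inv] at hb
  obtain ⟨μ, hμ⟩ := iInf_lt_iff.1 hb
  obtain ⟨hμ1, hμ2⟩ := iInf_lt_iff.1 hμ
  exact ⟨μ, hμ1, by rwa [h.toENNReal_energy] at hμ2⟩

theorem shiftMutual_smul_smul (h : PosDefKernel κ 0) (t : ℝ≥0) (μ : PosRadon X) :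
    shiftMutual κ 0 (t • μ) (t • μ) = t * (t * shiftMutual κ 0 μ μ) := by
  rw [shiftMutual_smul_left, h.shiftMutual_comm, shiftMutual_smul_left]

/-- The normalized restriction of `μ` to `Q` competes in the definition of the capacity of `E`. -/
theorem inv_interiorCapacity_mul_sq_le (h : PosDefKernel κ 0) {E Q : Set X}
    (hQ : IsCompact Q) (hQE : Q ⊆ E)
    (μ : PosRadon X) : (interiorCapacity κ E)⁻¹ * μ.toMeasure Q ^ 2 ≤ shiftMutual κ 0 μ μ := by
  by_cases h0 : μ.toMeasure Q = 0
  · simp [h0]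
  have hfin : μ.toMeasure Q ≠ ⊤ := hQ.measure_lt_top.ne
  obtain ⟨m, hm⟩ : ∃ m : ℝ≥0, (m : ℝ≥0∞) = μ.toMeasure Q := ⟨_, ENNReal.coe_toNNReal hfin⟩
  have hm0 : m ≠ 0 := by rintro rfl; exact h0 (by simpa using hm.symm)
  have hm1 : (m : ℝ≥0∞)⁻¹ * m = 1 :=
    ENNReal.inv_mul_cancel (by simpa using hm0) ENNReal.coe_ne_top
  have hunit : IsUnitMeasureOn E (m⁻¹ • μ.restrict Q hQ) := by
    refine ⟨?_, Q, hQ, hQE, ?_⟩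
    · simp only [PosRadon.smul_toMeasure, PosRadon.restrict_toMeasure, Measure.smul_apply,
        Measure.restrict_apply_univ, ENNReal.smul_def, smul_eq_mul, ← hm]
      rw [ENNReal.coe_inv hm0, hm1]
    · simp [hQ.measurableSet.compl]
  have h1 := h.inv_interiorCapacity_le hunit
  rw [h.shiftMutual_smul_smul, ENNReal.coe_inv hm0] at h1
  have h2 : shiftMutual κ 0 (μ.restrict Q hQ) (μ.restrict Q hQ) ≤ shiftMutual κ 0 μ μ :=
    shiftMutual_mono Measure.restrict_le_self Measure.restrict_le_self
  rw [← hm]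
  calc (interiorCapacity κ E)⁻¹ * (m : ℝ≥0∞) ^ 2
      ≤ ((m : ℝ≥0∞)⁻¹ * ((m : ℝ≥0∞)⁻¹ * shiftMutual κ 0 μ μ)) * (m : ℝ≥0∞) ^ 2 := by
        gcongr
        exact h1.trans (by gcongr)
    _ = ((m : ℝ≥0∞)⁻¹ * m) * ((m : ℝ≥0∞)⁻¹ * m) * shiftMutual κ 0 μ μ := by ring
    _ = shiftMutual κ 0 μ μ := by rw [hm1, one_mul, one_mul]

/-- `σ`-finiteness gives inner regularity on all measurable sets: a set of positive measure contains
a compact set of positive measure, which forces infinite energy. -/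
theorem measure_eq_zero_of_interiorCapacity_eq_zero (h : PosDefKernel κ 0) {μ : PosRadon X}
    (hμ : μ ∈ FiniteEnergyPlus κ) [SigmaFinite μ.toMeasure] {N : Set X} (hN : MeasurableSet N)
    (hcap : interiorCapacity κ N = 0) : μ.toMeasure N = 0 := by
  by_contra hne
  obtain ⟨Q, hQN, hQ, hpos⟩ := hN.exists_lt_isCompact (pos_iff_ne_zero.2 hne)
  have h1 := h.inv_interiorCapacity_mul_sq_le hQ hQN μ
  rw [hcap, ENNReal.inv_zero, ENNReal.top_mul (by simpa using hpos.ne')] at h1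
  exact (h.mem_finiteEnergyPlus_iff μ).1 hμ (top_le_iff.1 h1)

/-- For a consistent kernel, a set of finite interior capacity has small capacity outside a
suitable compact set. -/
theorem exists_isCompact_interiorCapacity_sdiff_le (h : PosDefKernel κ 0) (hw : WeaklyConsistent κ)
    {A : Set X} (hA : interiorCapacity κ A < ⊤) {ε : ℝ≥0} (hε : 0 < ε) :
    ∃ K : Set X, IsCompact K ∧ interiorCapacity κ (A \ K) ≤ ε := by
  by_contra hcon
  push Not at hcon
  -- If the claim fails, there are unit measures of energy below `1 / ε` outside every compact set.
  -- They tend vaguely to zero, hence weakly by consistency, so mixing them with a nearly minimal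
  -- measure produces no interaction in the limit.
  have hex : ∀ K : TopologicalSpace.Compacts X, ∃ ν : PosRadon X,
      IsUnitMeasureOn (A \ K) ν ∧ shiftMutual κ 0 ν ν < ((ε⁻¹ : ℝ≥0) : ℝ≥0∞) := fun K => by
    refine h.exists_unitMeasure_lt ?_
    rw [ENNReal.coe_inv hε.ne', ENNReal.inv_lt_inv]
    exact hcon K K.isCompact
  choose ν hνunit hνlt using hex
  have hνE : ∀ K, ν K ∈ FiniteEnergyPlus κ := fun K =>
    (h.mem_finiteEnergyPlus_iff _).2 ((hνlt K).trans ENNReal.coe_lt_top).ne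
  have hνN : ∀ K, mutualReal κ (ν K) (ν K) ≤ (ε⁻¹ : ℝ≥0) := fun K => by
    rw [h.mutualReal_eq_toReal]
    exact ENNReal.toReal_le_coe_of_le_coe (hνlt K).le
  have hvague : Tendsto ν atTop (𝓝 0) := by
    rw [tendsto_posRadon_iff]
    intro φ
    refine tendsto_const_nhds.congr' ?_
    filter_upwards [eventually_ge_atTop
      (⟨tsupport φ, φ.hasCompactSupport⟩ : TopologicalSpace.Compacts X)] with K hK
    obtain ⟨-, L, -, hLA, hL⟩ := hνunit K
    have hae : ∀ᵐ x ∂(ν K).toMeasure, φ x = 0 := by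
      filter_upwards [show ∀ᵐ x ∂(ν K).toMeasure, x ∈ L from hL] with x hx
      by_contra hne
      exact (hLA hx).2 (hK (subset_tsupport _ hne))
    rw [integral_congr_ae hae]
    simp
  obtain ⟨-, hweak⟩ := hw (map ν atTop) inferInstance (mem_map.2 (univ_mem' hνE))
    ⟨_, Eventually.of_forall (f := atTop) hνN⟩ 0 hvague
  -- the minimal energy on `A`
  have hv0 : (interiorCapacity κ A)⁻¹ ≠ 0 := ENNReal.inv_ne_zero.2 hA.ne
  have hvtop : (interiorCapacity κ A)⁻¹ ≠ ⊤ :=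
    ne_top_of_le_ne_top ((hνlt ⊥).trans ENNReal.coe_lt_top).ne
      (h.inv_interiorCapacity_le ((hνunit ⊥).mono sdiff_subset))
  obtain ⟨v, hv⟩ : ∃ v : ℝ≥0, (v : ℝ≥0∞) = (interiorCapacity κ A)⁻¹ :=
    ⟨_, ENNReal.coe_toNNReal hvtop⟩
  have hvpos : 0 < v := by
    rw [pos_iff_ne_zero]; rintro rfl; exact hv0 (by simpa using hv.symm)
  have hmin : ∀ ρ, IsUnitMeasureOn A ρ → ρ ∈ FiniteEnergyPlus κ → (v : ℝ) ≤ mutualReal κ ρ ρ := by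
    intro ρ hρ hρE
    have h1 := h.inv_interiorCapacity_le hρ
    rw [← hv] at h1
    rw [h.mutualReal_eq_toReal]
    have := ENNReal.toReal_mono ((h.mem_finiteEnergyPlus_iff ρ).1 hρE) h1
    simpa using this
  set b : ℝ≥0 := ε⁻¹ with hb
  -- This weight minimizes `(1 - t)² v + t² b`, the limiting energy of a mixture, with minimum `v -
  -- t v`. The minimal energy `v` is positive because the capacity of `A` is finite, so the gain `t
  -- v` is positive too.
  let t : ℝ≥0 := v / (v + b)
  have ht : t ≤ 1 := div_le_one_of_le₀ (by simp) (by simp)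
  have htR : (t : ℝ) * (v + b) = v := by
    have : t * (v + b) = v := div_mul_cancel₀ _ (by positivity)
    exact_mod_cast this
  have htpos : 0 < t := by positivity
  let s : ℝ≥0 := 1 - t
  have hst : s + t = 1 := tsub_add_cancel_of_le ht
  have hstR : (s : ℝ) = 1 - t := by
    have : (s : ℝ) + t = 1 := by exact_mod_cast hst
    linarith
  -- The errors from the near-minimizer and from the cross terms add up to `(1 - t²) δ`, less than
  -- the gain `t v`.
  let δ : ℝ≥0 := t * v / 2
  have hδ : 0 < δ := by positivity
  have hδR : (δ : ℝ) = t * v / 2 := by simp [δ]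
  obtain ⟨ρ, hρunit, hρlt⟩ := h.exists_unitMeasure_lt (E := A) (b := ((v + δ : ℝ≥0) : ℝ≥0∞))
    (by rw [← hv]; exact_mod_cast lt_add_of_pos_right v hδ)
  have hρE : ρ ∈ FiniteEnergyPlus κ :=
    (h.mem_finiteEnergyPlus_iff _).2 (hρlt.trans ENNReal.coe_lt_top).ne
  have hρN : mutualReal κ ρ ρ ≤ v + δ := by
    rw [h.mutualReal_eq_toReal]
    exact_mod_cast ENNReal.toReal_le_coe_of_le_coe hρlt.le
  have hlim := hweak ρ hρE
  rw [h.mutualReal_zero_left, tendsto_map'_iff] at hlim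
  obtain ⟨K, hK⟩ := (hlim.eventually (gt_mem_nhds (NNReal.coe_pos.2 hδ))).exists
  have h1 := hmin _ (hρunit.convex ((hνunit K).mono sdiff_subset) hst)
    (h.add_mem (h.smul_mem s hρE) (h.smul_mem t (hνE K)))
  have hs' := h.smul_mem s hρE
  have ht' := h.smul_mem t (hνE K)
  rw [h.mutualReal_add_left hs' ht' (h.add_mem hs' ht'), h.mutualReal_add_right hs' hs' ht',
    h.mutualReal_add_right ht' hs' ht', h.mutualReal_smul_left s hρE hs',
    h.mutualReal_smul_left s hρE ht', h.mutualReal_smul_left t (hνE K) hs',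
    h.mutualReal_smul_left t (hνE K) ht', h.mutualReal_smul_right s hρE hρE,
    h.mutualReal_smul_right t hρE (hνE K), h.mutualReal_smul_right s (hνE K) hρE,
    h.mutualReal_smul_right t (hνE K) (hνE K), h.mutualReal_comm ρ (ν K)] at h1
  have hK' : mutualReal κ (ν K) ρ < δ := hK
  have h2 := hνN K
  have hs0 : (0 : ℝ) ≤ s := s.2
  have ht0 : (0 : ℝ) < t := htpos
  have e1 : (s : ℝ) * (s * mutualReal κ ρ ρ) ≤ s * (s * (v + δ)) := by gcongr
  have e2 : (t : ℝ) * (t * mutualReal κ (ν K) (ν K)) ≤ t * (t * b) := by gcongr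
  have e3 : (s : ℝ) * (t * mutualReal κ (ν K) ρ) ≤ s * (t * δ) := by gcongr
  have e4 : (t : ℝ) * (s * mutualReal κ (ν K) ρ) ≤ t * (s * δ) := by gcongr
  have e5 : (v : ℝ) ≤ s * s * v + (1 - t * t) * δ + t * t * b := by
    rw [hstR] at *
    linarith
  have e6 : (t : ℝ) * t * b = t * v - t * t * v := by
    have : (t : ℝ) * b = v - t * v := by linarith
    rw [mul_assoc, this]; ring
  have hvR : (0 : ℝ) < v := hvpos
  have hδ0 : (0 : ℝ) < δ := hδ
  rw [hstR, e6] at e5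
  nlinarith [mul_pos ht0 hvR, mul_pos (mul_pos ht0 ht0) hδ0]

/-- A compact `Q` outside `K` satisfies `μ(Q)² ≤ C(A \ K) κ(μ, μ)`. Making this capacity at most `η²
/ (b + 1)` suffices, the summand `1` preventing division by zero. -/
theorem exists_isCompact_measure_compl_le (h : PosDefKernel κ 0) (hw : WeaklyConsistent κ)
    {A : Set X} (hA : IsClosed A) (hcap : interiorCapacity κ A < ⊤) (b : ℝ≥0) {η : ℝ≥0} (hη : 0 < η) :
    ∃ K : Set X, IsCompact K ∧ ∀ μ : PosRadon X, μ.toMeasure Aᶜ = 0 →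
      shiftMutual κ 0 μ μ ≤ b → μ.toMeasure Kᶜ ≤ η := by
  obtain ⟨K, hK, hKε⟩ := h.exists_isCompact_interiorCapacity_sdiff_le hw hcap
    (ε := η ^ 2 / (b + 1)) (by positivity)
  refine ⟨K, hK, fun μ hμA hμb => ?_⟩
  rw [hK.isClosed.isOpen_compl.measure_eq_iSup_isCompact]
  refine iSup₂_le fun Q hQK => iSup_le fun hQ => ?_
  have h1 := h.inv_interiorCapacity_mul_sq_le (E := A \ K) (hQ.inter_right hA)
    (fun x hx => ⟨hx.2, hQK hx.1⟩) μ
  have h2 : μ.toMeasure (Q ∩ A) = μ.toMeasure Q := by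
    refine le_antisymm (measure_mono inter_subset_left) ?_
    calc μ.toMeasure Q ≤ μ.toMeasure (Q ∩ A ∪ Aᶜ) := measure_mono fun x hx => by
          by_cases hxA : x ∈ A
          · exact .inl ⟨hx, hxA⟩
          · exact .inr hxA
      _ ≤ μ.toMeasure (Q ∩ A) := (measure_union_le _ _).trans (by rw [hμA, add_zero])
  rw [h2] at h1
  have hfin : μ.toMeasure Q ≠ ⊤ := hQ.measure_lt_top.ne
  obtain ⟨m, hm⟩ : ∃ m : ℝ≥0, (m : ℝ≥0∞) = μ.toMeasure Q := ⟨_, ENNReal.coe_toNNReal hfin⟩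
  rw [← hm] at h1 ⊢
  have h3 : (((η ^ 2 / (b + 1))⁻¹ : ℝ≥0) : ℝ≥0∞) * (m : ℝ≥0∞) ^ 2 ≤ b := by
    refine le_trans ?_ (h1.trans hμb)
    gcongr
    rw [ENNReal.coe_inv (by positivity)]
    exact ENNReal.inv_le_inv.2 hKε
  have h4 : (η ^ 2 / (b + 1))⁻¹ * m ^ 2 ≤ b := by exact_mod_cast h3
  rw [inv_div, div_mul_eq_mul_div, div_le_iff₀ (by positivity)] at h4
  have h5 : m ^ 2 ≤ η ^ 2 := by
    by_contra hlt
    rw [not_le] at hlt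
    have : (b + 1) * η ^ 2 < (b + 1) * m ^ 2 := by gcongr
    have h6 : b * η ^ 2 ≤ (b + 1) * η ^ 2 := by gcongr; simp
    exact absurd (h4.trans h6) (not_le.2 this)
  exact_mod_cast (pow_le_pow_iff_left₀ (by simp) (by simp) two_ne_zero).1 h5

end PosDefKernel

end Capacity

/-! ### Uniform smallness of `∫ g dμ` near infinity -/

section Tightness

variable {X : Type*} [TopologicalSpace X] [T2Space X] [LocallyCompactSpace X] [MeasurableSpace X]
  [BorelSpace X] {κ : X → X → EReal}

/-- The sets `{f ≥ 1 / (n + 1)}` exhaust the space and have finite measure by Markov's inequality.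
-/
theorem sigmaFinite_of_lintegral_ne_top {Ω : Type*} [MeasurableSpace Ω] {μ : Measure Ω}
    {f : Ω → ℝ≥0∞} (hf : Measurable f) (hpos : ∀ x, f x ≠ 0) (hfin : ∫⁻ x, f x ∂μ ≠ ⊤) :
    SigmaFinite μ := by
  refine ⟨⟨⟨fun n => {x | ((n : ℝ≥0∞) + 1)⁻¹ ≤ f x}, fun _ => trivial, fun n => ?_, ?_⟩⟩⟩
  · have h0 : ((n : ℝ≥0∞) + 1)⁻¹ ≠ 0 := ENNReal.inv_ne_zero.2 (by finiteness)
    exact (meas_ge_le_lintegral_div hf.aemeasurable h0 (by simp)).trans_lt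
      (ENNReal.div_lt_top hfin h0)
  · refine eq_univ_of_forall fun x => mem_iUnion.2 ?_
    obtain ⟨n, hn⟩ := ENNReal.exists_inv_nat_lt (hpos x)
    exact ⟨n, (ENNReal.inv_le_inv.2 le_self_add).trans hn.le⟩

namespace PosDefKernel

theorem shiftMutual_le (h : PosDefKernel κ 0) {μ ν : PosRadon X} {b d : ℝ≥0}
    (hμ : shiftMutual κ 0 μ μ ≤ b) (hν : shiftMutual κ 0 ν ν ≤ d) :
    shiftMutual κ 0 μ ν ≤ ((b + d : ℝ≥0) : ℝ≥0∞) := by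
  have hμE : μ ∈ FiniteEnergyPlus κ :=
    (h.mem_finiteEnergyPlus_iff μ).2 (hμ.trans_lt ENNReal.coe_lt_top).ne
  have hνE : ν ∈ FiniteEnergyPlus κ :=
    (h.mem_finiteEnergyPlus_iff ν).2 (hν.trans_lt ENNReal.coe_lt_top).ne
  have h1 := h.abs_mutualReal_le hμE hνE
  simp only [h.mutualReal_eq_toReal] at h1
  have h2 : (shiftMutual κ 0 μ μ).toReal ≤ b := ENNReal.toReal_le_coe_of_le_coe hμ
  have h3 : (shiftMutual κ 0 ν ν).toReal ≤ d := ENNReal.toReal_le_coe_of_le_coe hν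
  have h4 := le_abs_self (shiftMutual κ 0 μ ν).toReal
  have hb := b.2
  have hd := d.2
  rw [← ENNReal.toReal_le_toReal (h.shiftMutual_ne_top hμE hνE) ENNReal.coe_ne_top]
  simp only [ENNReal.coe_toReal, NNReal.coe_add]
  have h5 := abs_nonneg (shiftMutual κ 0 μ ν).toReal
  linarith

/-- Finite energy measures do not charge measurable sets of capacity zero. Replacing `κ(·, ω)` by
the larger potential of `ω⁺`, which is lower semicontinuous, gives a measurable exceptional set. -/
theorem ae_rpow_le_potential (h : PosDefKernel κ 0) {A : Set X} (hA : IsClosed A) {g : X → ℝ}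
    (hg : Continuous g) (hpos : ∀ x, 0 < g x) {r : ℝ} {ω : Radon X}
    (hne : NearlyEverywhere κ A fun x => ((g x ^ r : ℝ) : EReal) ≤ potential κ ω x)
    {μ : PosRadon X} (hμ : μ ∈ FiniteEnergyPlus κ) (hμA : μ.toMeasure Aᶜ = 0)
    (hint : ∫⁻ x, ENNReal.ofReal (g x) ∂μ.toMeasure ≠ ⊤) :
    ∀ᵐ x ∂μ.toMeasure, ENNReal.ofReal (g x ^ r) ≤
      ∫⁻ y, shiftKernel κ 0 x y ∂ω.pos.toMeasure := by
  have hgm : Measurable fun x => ENNReal.ofReal (g x) := by fun_prop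
  have := sigmaFinite_of_lintegral_ne_top hgm (fun x => by simpa using hpos x) hint
  have hgr : Continuous fun x => g x ^ r := hg.rpow_const fun x => .inl (hpos x).ne'
  let N : Set X := {x ∈ A | ¬ ENNReal.ofReal (g x ^ r) ≤
    ∫⁻ y, shiftKernel κ 0 x y ∂ω.pos.toMeasure}
  have hN : MeasurableSet N := hA.measurableSet.inter (measurableSet_le
    (by fun_prop) (measurable_shiftPotential h.isKernel 0 ω.pos)).compl
  have hsub : N ⊆ {x ∈ A | ¬ ((g x ^ r : ℝ) : EReal) ≤ potential κ ω x} := by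
    rintro x ⟨hxA, hx⟩
    refine ⟨hxA, fun hle => hx ?_⟩
    have hp : ∀ ν : PosRadon X, posPotential κ ν x =
        ((∫⁻ y, shiftKernel κ 0 x y ∂ν.toMeasure : ℝ≥0∞) : EReal) := fun ν => by
      rw [posPotential_eq h.isKernel h.bound]; simp
    have h1 : potential κ ω x ≤
        ((∫⁻ y, shiftKernel κ 0 x y ∂ω.pos.toMeasure : ℝ≥0∞) : EReal) := by
      rw [potential, hp, hp]
      exact EReal.sub_le_of_le_add (le_add_of_nonneg_right (EReal.coe_ennreal_nonneg _))
    have h2 := EReal.toENNReal_le_toENNReal (hle.trans h1)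
    rwa [EReal.toENNReal_coe, EReal.toENNReal_of_ne_top (EReal.coe_ne_top _),
      EReal.toReal_coe] at h2
  have hcap : interiorCapacity κ N = 0 := le_antisymm ((interiorCapacity_mono hsub).trans hne.le)
    zero_le
  have hnull := h.measure_eq_zero_of_interiorCapacity_eq_zero hμ hN hcap
  filter_upwards [show ∀ᵐ x ∂μ.toMeasure, x ∈ A from hμA,
    show ∀ᵐ x ∂μ.toMeasure, x ∉ N from measure_eq_zero_iff_ae_notMem.1 hnull] with x hxA hxN
  by_contra hcon
  exact hxN ⟨hxA, hcon⟩

/-- Uniform integrability of `g` over the measures on `A` of bounded energy. -/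
theorem exists_setLIntegral_le (h : PosDefKernel κ 0) {A : Set X} (hA : IsClosed A) {g : X → ℝ}
    (hg : Continuous g) (hpos : ∀ x, 0 < g x)
    (hgrowth : BddAbove (g '' A) ∨ ∃ r : ℝ, 1 < r ∧ ∃ ω ∈ FiniteEnergy κ,
      NearlyEverywhere κ A fun x => ((g x ^ r : ℝ) : EReal) ≤ potential κ ω x)
    (b : ℝ≥0) {η : ℝ≥0} (hη : 0 < η) :
    ∃ T : ℝ≥0, ∀ μ : PosRadon X, μ.toMeasure Aᶜ = 0 → shiftMutual κ 0 μ μ ≤ b →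
      ∫⁻ x, ENNReal.ofReal (g x) ∂μ.toMeasure ≠ ⊤ → ∀ S : Set X,
        ∫⁻ x in S, ENNReal.ofReal (g x) ∂μ.toMeasure ≤ T * μ.toMeasure S + η := by
  rcases hgrowth with ⟨M, hM⟩ | ⟨r, hr, ω, hω, hne⟩
  · refine ⟨M.toNNReal, fun μ hμA _ _ S => le_add_right ?_⟩
    rw [← setLIntegral_const]
    refine lintegral_mono_ae (ae_restrict_of_ae ?_)
    filter_upwards [show ∀ᵐ x ∂μ.toMeasure, x ∈ A from hμA] with x hx
    exact ENNReal.ofReal_le_ofReal (hM (mem_image_of_mem g hx))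
  · have hωE := (h.pos_neg_mem hω).1
    obtain ⟨d, hd⟩ : ∃ d : ℝ≥0, (d : ℝ≥0∞) = shiftMutual κ 0 ω.pos ω.pos :=
      ⟨_, ENNReal.coe_toNNReal ((h.mem_finiteEnergyPlus_iff _).1 hωE)⟩
    -- Since `∫ g ^ r dμ ≤ κ(μ, ω⁺) ≤ b + d`, the part of `∫ g dμ` where `g ≥ T` is at most `T ^
    -- (-(r - 1)) (b + d)`, which is small for large `T`.
    have hlim : Tendsto (fun T : ℝ => T ^ (-(r - 1)) * ((b + d : ℝ≥0) : ℝ)) atTop (𝓝 0) := by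
      simpa using (tendsto_rpow_neg_atTop (sub_pos.2 hr)).mul_const ((b + d : ℝ≥0) : ℝ)
    obtain ⟨T, hTη, hT⟩ := ((hlim.eventually (gt_mem_nhds (NNReal.coe_pos.2 hη))).and
      (eventually_gt_atTop 0)).exists
    refine ⟨T.toNNReal, fun μ hμA hμb hint S => ?_⟩
    have hμE : μ ∈ FiniteEnergyPlus κ :=
      (h.mem_finiteEnergyPlus_iff μ).2 (hμb.trans_lt ENNReal.coe_lt_top).ne
    have hgr : Continuous fun x => g x ^ r := hg.rpow_const fun x => .inl (hpos x).ne'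
    have hpow : ∫⁻ x, ENNReal.ofReal (g x ^ r) ∂μ.toMeasure ≤ ((b + d : ℝ≥0) : ℝ≥0∞) :=
      (lintegral_mono_ae (h.ae_rpow_le_potential hA hg hpos hne hμE hμA hint)).trans
        (h.shiftMutual_le hμb hd.ge)
    have hpt : ∀ x, ENNReal.ofReal (g x) ≤ (T.toNNReal : ℝ≥0∞) +
        ENNReal.ofReal (T ^ (-(r - 1))) * ENNReal.ofReal (g x ^ r) := fun x => by
      have hTr : 0 ≤ T ^ (-(r - 1)) := by positivity
      have hgrx : 0 ≤ g x ^ r := Real.rpow_nonneg (hpos x).le _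
      rw [← ENNReal.ofReal_mul hTr]
      change _ ≤ ENNReal.ofReal T + _
      rw [← ENNReal.ofReal_add hT.le (mul_nonneg hTr hgrx)]
      refine ENNReal.ofReal_le_ofReal ?_
      rcases le_total (g x) T with hle | hle
      · linarith [mul_nonneg hTr hgrx]
      · have h1 : g x = g x ^ (-(r - 1)) * g x ^ r := by
          rw [← Real.rpow_add (hpos x)]; simp
        have h2 : g x ^ (-(r - 1)) ≤ T ^ (-(r - 1)) :=
          Real.rpow_le_rpow_of_nonpos hT hle (by linarith)
        have h3 := mul_le_mul_of_nonneg_right h2 hgrx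
        linarith
    calc ∫⁻ x in S, ENNReal.ofReal (g x) ∂μ.toMeasure
        ≤ ∫⁻ x in S, ((T.toNNReal : ℝ≥0∞) +
            ENNReal.ofReal (T ^ (-(r - 1))) * ENNReal.ofReal (g x ^ r)) ∂μ.toMeasure :=
          lintegral_mono hpt
      _ = T.toNNReal * μ.toMeasure S + ENNReal.ofReal (T ^ (-(r - 1))) *
            ∫⁻ x in S, ENNReal.ofReal (g x ^ r) ∂μ.toMeasure := by
          rw [lintegral_add_left measurable_const, setLIntegral_const,
            lintegral_const_mul _ (by fun_prop)]
      _ ≤ T.toNNReal * μ.toMeasure S + η := by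
          gcongr
          calc ENNReal.ofReal (T ^ (-(r - 1))) * ∫⁻ x in S, ENNReal.ofReal (g x ^ r) ∂μ.toMeasure
              ≤ ENNReal.ofReal (T ^ (-(r - 1))) * ((b + d : ℝ≥0) : ℝ≥0∞) := by
                gcongr
                exact (setLIntegral_le_lintegral _ _).trans hpow
            _ = ENNReal.ofReal (T ^ (-(r - 1)) * ((b + d : ℝ≥0) : ℝ)) := by
                rw [ENNReal.ofReal_mul (by positivity), ENNReal.ofReal_coe_nnreal]
            _ ≤ η := by
                rw [← ENNReal.ofReal_coe_nnreal (p := η)]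
                exact ENNReal.ofReal_le_ofReal hTη.le

/-- For a compact plate nothing lies outside it. Otherwise uniform integrability turns small mass
near infinity into small `∫ g dμ`. -/
theorem exists_isCompact_setLIntegral_compl_le (h : PosDefKernel κ 0) (hw : WeaklyConsistent κ)
    {A : Set X} (hA : IsClosed A) (hplate : IsCompact A ∨ interiorCapacity κ A < ⊤) {g : X → ℝ}
    (hg : Continuous g) (hpos : ∀ x, 0 < g x)
    (hgrowth : BddAbove (g '' A) ∨ ∃ r : ℝ, 1 < r ∧ ∃ ω ∈ FiniteEnergy κ,
      NearlyEverywhere κ A fun x => ((g x ^ r : ℝ) : EReal) ≤ potential κ ω x)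
    (b : ℝ≥0) {η : ℝ≥0} (hη : 0 < η) :
    ∃ K : Set X, IsCompact K ∧ ∀ μ : PosRadon X, μ.toMeasure Aᶜ = 0 → shiftMutual κ 0 μ μ ≤ b →
      ∫⁻ x, ENNReal.ofReal (g x) ∂μ.toMeasure ≠ ⊤ →
        ∫⁻ x in Kᶜ, ENNReal.ofReal (g x) ∂μ.toMeasure ≤ η := by
  rcases hplate with hAc | hcap
  · refine ⟨A, hAc, fun μ hμA _ _ => ?_⟩
    rw [setLIntegral_measure_zero _ _ hμA]
    exact zero_le
  · obtain ⟨T, hT⟩ := h.exists_setLIntegral_le hA hg hpos hgrowth b (half_pos hη)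
    obtain ⟨K, hK, hKμ⟩ := h.exists_isCompact_measure_compl_le hw hA hcap b
      (η := η / 2 / (T + 1)) (by positivity)
    refine ⟨K, hK, fun μ hμA hμb hint => (hT μ hμA hμb hint Kᶜ).trans ?_⟩
    have h1 : T * (η / 2 / (T + 1)) ≤ η / 2 := by
      rw [mul_div_assoc', div_le_iff₀ (by positivity), mul_comm]
      gcongr
      simp
    calc (T : ℝ≥0∞) * μ.toMeasure Kᶜ + (η / 2 : ℝ≥0)
        ≤ T * (η / 2 / (T + 1) : ℝ≥0) + (η / 2 : ℝ≥0) := by gcongr; exact hKμ μ hμA hμb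
      _ ≤ (η / 2 : ℝ≥0) + (η / 2 : ℝ≥0) := by gcongr; exact_mod_cast h1
      _ = η := by rw [← ENNReal.coe_add, add_halves]

end PosDefKernel

end Tightness

/-! ### Vague limits -/

section Vague

variable {X : Type*} [TopologicalSpace X] [T2Space X] [LocallyCompactSpace X] [MeasurableSpace X]
  [BorelSpace X] {α : Type*}

theorem exists_forall_abs_integral_le (φ : C_c(X, ℝ)) :
    ∃ M : ℝ, ∀ μ : PosRadon X,
      |∫ x, φ x ∂μ.toMeasure| ≤ M * (μ.toMeasure (tsupport φ)).toReal := by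
  obtain ⟨M, hM⟩ := φ.continuous.bounded_above_of_compact_support φ.hasCompactSupport
  refine ⟨M, fun μ => ?_⟩
  rw [← setIntegral_eq_integral_of_forall_compl_eq_zero (s := tsupport φ)
    fun x hx => image_eq_zero_of_notMem_tsupport hx]
  exact norm_setIntegral_le_of_norm_le_const φ.hasCompactSupport.isCompact.measure_lt_top
    fun x _ => hM x

/-- A vaguely bounded ultrafilter of measures supported by a closed set converges vaguely. -/
theorem exists_tendsto_of_ultrafilter (U : Ultrafilter α) (f : α → PosRadon X) {E : Set X}
    (hE : IsClosed E) (hfE : ∀ a, (f a).toMeasure Eᶜ = 0)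
    (hbdd : ∀ K : Set X, IsCompact K → ∃ C : ℝ≥0, ∀ᶠ a in (U : Filter α),
      (f a).toMeasure K ≤ C) :
    ∃ μ : PosRadon X, μ.toMeasure Eᶜ = 0 ∧ Tendsto f U (𝓝 μ) := by
  have hex : ∀ φ : C_c(X, ℝ), ∃ L : ℝ,
      Tendsto (fun a => ∫ x, φ x ∂(f a).toMeasure) U (𝓝 L) := fun φ => by
    obtain ⟨M, hM⟩ := exists_forall_abs_integral_le φ
    obtain ⟨C, hC⟩ := hbdd _ φ.hasCompactSupport.isCompact
    have hmem : ∀ᶠ a in (U : Filter α), ∫ x, φ x ∂(f a).toMeasure ∈ Icc (-(|M| * C)) (|M| * C) := by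
      filter_upwards [hC] with a ha
      rw [mem_Icc, ← abs_le]
      have h1 : ((f a).toMeasure (tsupport φ)).toReal ≤ C := ENNReal.toReal_le_coe_of_le_coe ha
      calc _ ≤ M * ((f a).toMeasure (tsupport φ)).toReal := hM _
        _ ≤ |M| * ((f a).toMeasure (tsupport φ)).toReal := by gcongr; exact le_abs_self M
        _ ≤ |M| * C := by gcongr
    obtain ⟨L, -, hL⟩ := isCompact_Icc.ultrafilter_le_nhds
      (U.map fun a => ∫ x, φ x ∂(f a).toMeasure) (le_principal_iff.2 hmem)
    exact ⟨L, hL⟩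
  choose L hL using hex
  -- The limits along the ultrafilter form a positive linear functional, represented by a Radon
  -- measure.
  let Λ : C_c(X, ℝ) →ₚ[ℝ] ℝ := PositiveLinearMap.mk₀
    { toFun := L
      map_add' := fun φ ψ => tendsto_nhds_unique (hL (φ + ψ)) <| by
        refine ((hL φ).add (hL ψ)).congr fun a => ?_
        exact (integral_add φ.integrable ψ.integrable).symm
      map_smul' := fun r φ => tendsto_nhds_unique (hL (r • φ)) <| by
        refine ((hL φ).const_mul r).congr fun a => ?_
        exact (integral_const_mul r _).symm }
    fun φ hφ => ge_of_tendsto' (hL φ) fun a => integral_nonneg hφ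
  have hΛ : ∀ φ, ∫ x, φ x ∂(RealRMK.rieszMeasure Λ) = L φ := fun φ =>
    RealRMK.integral_rieszMeasure Λ φ
  refine ⟨⟨RealRMK.rieszMeasure Λ, inferInstance⟩, ?_, tendsto_posRadon_iff.2 fun φ => ?_⟩
  · change RealRMK.rieszMeasure Λ Eᶜ = 0
    rw [hE.isOpen_compl.measure_eq_iSup_isCompact]
    refine le_antisymm (iSup₂_le fun K hKE => iSup_le fun hK => ?_) zero_le
    obtain ⟨φ, hφ1, hφc, hφs, hφ⟩ := exists_continuousMap_one_of_isCompact_subset_isOpen hK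
      hE.isOpen_compl hKE
    let ψ : C_c(X, ℝ) := ⟨φ, hφc⟩
    have h1 := RealRMK.rieszMeasure_le_of_eq_one Λ (f := ψ) (fun x => (hφ x).1) hK
      fun x hx => hφ1 hx
    have h2 : Λ ψ = 0 := by
      refine tendsto_nhds_unique (hL ψ) (tendsto_const_nhds.congr fun a => ?_)
      refine (integral_eq_zero_of_ae ?_).symm
      filter_upwards [show ∀ᵐ x ∂(f a).toMeasure, x ∈ E from hfE a] with x hx
      exact image_eq_zero_of_notMem_tsupport fun hx' => hφs hx' hx
    rw [h2] at h1
    simpa using h1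
  · simp only [hΛ]
    exact hL φ

/-- The integral of `g` is a supremum of integrals of compactly supported continuous functions, each
of which passes to the limit. -/
theorem lintegral_le_of_tendsto {l : Filter α} [l.NeBot] {f : α → PosRadon X} {μ : PosRadon X}
    (hf : Tendsto f l (𝓝 μ)) {g : X → ℝ≥0∞} (hg : LowerSemicontinuous g) {b : ℝ≥0∞}
    (hb : ∀ᶠ a in l, ∫⁻ x, g x ∂(f a).toMeasure ≤ b) : ∫⁻ x, g x ∂μ.toMeasure ≤ b := by
  rw [lintegral_eq_iSup_ccBelow _ hg]
  refine iSup_le fun φ => ?_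
  have h1 := ENNReal.tendsto_ofReal (tendsto_posRadon_iff.1 hf φ.1.toReal)
  simp only [CompactlySupportedContinuousMap.toReal_apply] at h1
  rw [lintegral_coe_cc (f := φ.1) _ φ.1.continuous φ.1.hasCompactSupport]
  refine le_of_tendsto h1 ?_
  filter_upwards [hb] with a ha
  rw [← lintegral_coe_cc (f := φ.1) _ φ.1.continuous φ.1.hasCompactSupport]
  exact (lintegral_mono φ.2).trans ha

/-- Multiplying `g` by a cutoff equal to `1` on `K` costs at most `η` by tightness and leaves a test
function for vague convergence. -/
theorem le_lintegral_of_tendsto {l : Filter α} [l.NeBot] {f : α → PosRadon X} {μ : PosRadon X}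
    (hf : Tendsto f l (𝓝 μ)) {g : X → ℝ} (hg : Continuous g) {b : ℝ≥0∞}
    (hb : ∀ᶠ a in l, b ≤ ∫⁻ x, ENNReal.ofReal (g x) ∂(f a).toMeasure)
    (htight : ∀ η : ℝ≥0, 0 < η → ∃ K : Set X, IsCompact K ∧
      ∀ᶠ a in l, ∫⁻ x in Kᶜ, ENNReal.ofReal (g x) ∂(f a).toMeasure ≤ η) :
    b ≤ ∫⁻ x, ENNReal.ofReal (g x) ∂μ.toMeasure := by
  refine ENNReal.le_of_forall_pos_le_add fun η hη _ => ?_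
  obtain ⟨K, hK, hKη⟩ := htight η hη
  obtain ⟨χ, hχ1, hχc, -, hχ⟩ := exists_continuousMap_one_of_isCompact_subset_isOpen hK
    isOpen_univ (subset_univ K)
  let φ : C_c(X, ℝ≥0) :=
    { toFun := fun x => (χ x).toNNReal * (g x).toNNReal
      continuous_toFun := by fun_prop
      hasCompactSupport' := by
        refine HasCompactSupport.intro hχc fun x hx => ?_
        simp [image_eq_zero_of_notMem_tsupport hx] }
  have hφ : ∀ x, φ x = (χ x).toNNReal * (g x).toNNReal := fun _ => rfl
  have hφle : ∀ x, (φ x : ℝ≥0∞) ≤ ENNReal.ofReal (g x) := fun x => by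
    rw [hφ, ENNReal.ofReal, ENNReal.coe_le_coe]
    exact mul_le_of_le_one_left' (by simpa using (hχ x).2)
  have h1 := ENNReal.tendsto_ofReal (tendsto_posRadon_iff.1 hf φ.toReal)
  simp only [CompactlySupportedContinuousMap.toReal_apply] at h1
  have h2 : b ≤ ENNReal.ofReal (∫ x, (φ x : ℝ) ∂μ.toMeasure) + η := by
    refine ge_of_tendsto (h1.add_const (η : ℝ≥0∞)) ?_
    filter_upwards [hb, hKη] with a ha haη
    rw [← lintegral_coe_cc (f := φ) _ φ.continuous φ.hasCompactSupport]
    refine ha.trans ?_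
    rw [← lintegral_add_compl _ hK.measurableSet]
    refine add_le_add ?_ haη
    refine le_trans (setLIntegral_mono' hK.measurableSet fun x hx => ?_)
      (setLIntegral_le_lintegral K _)
    simp [hφ, hχ1 hx, ENNReal.ofReal]
  rw [← lintegral_coe_cc (f := φ) _ φ.continuous φ.hasCompactSupport] at h2
  exact h2.trans (by gcongr; exact hφle _)

end Vague

/-! ### Sums of coordinates under `A`-vague convergence. -/

namespace Condenser

variable {X : Type*} [TopologicalSpace X] [T2Space X] [LocallyCompactSpace X] [MeasurableSpace X]
  [BorelSpace X] {ι : Type*} [Countable ι]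

/-- The map `μ ↦ ∑_{i ∈ J} μⁱ` is continuous. -/
theorem continuous_sumOver (A : Condenser X ι) (J : Set ι) :
    Continuous fun μ : A.Measures => A.sumOver μ J := by
  refine continuous_iff_continuousAt.2 fun μ₀ => tendsto_posRadon_iff.2 fun φ => ?_
  -- Only finitely many plates meet the support of `φ`, so its integral is a fixed finite sum of
  -- coordinate integrals.
  have hfin : {i : J | (A.plate i ∩ tsupport φ).Nonempty}.Finite :=
    Set.Finite.preimage (f := Subtype.val) Subtype.val_injective.injOn
      (A.finite_inter _ φ.hasCompactSupport.isCompact)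
  have hsum : ∀ μ : A.Measures, ∫ x, φ x ∂(A.sumOver μ J).toMeasure =
      ∑ i ∈ hfin.toFinset, ∫ x, φ x ∂(μ i).1.toMeasure := fun μ => by
    have hint : Integrable φ (Measure.sum fun i : J => (μ i).1.toMeasure) :=
      φ.integrable (μ := (A.sumOver μ J).toMeasure)
    refine (integral_sum_measure hint).trans (tsum_eq_sum fun i hi => ?_)
    refine integral_eq_zero_of_ae ?_
    filter_upwards [show ∀ᵐ x ∂(μ i).1.toMeasure, x ∈ A.plate i from (μ i).2] with x hx
    refine image_eq_zero_of_notMem_tsupport fun hx' => hi ?_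
    rw [Set.Finite.mem_toFinset]
    exact ⟨x, hx, hx'⟩
  simp_rw [hsum]
  refine tendsto_finsetSum _ fun i _ => tendsto_posRadon_iff.1 ?_ φ
  exact ((continuous_subtype_val.comp (continuous_apply (i : ι))).tendsto μ₀)

theorem le_sumOver (A : Condenser X ι) (μ : A.Measures) {J : Set ι} {i : ι} (hi : i ∈ J) :
    (μ i).1.toMeasure ≤ (A.sumOver μ J).toMeasure :=
  Measure.le_sum (fun i : J => (μ i).1.toMeasure) ⟨i, hi⟩

end Condenser

/-! ### Condensers -/

namespace Condenser

variable {X : Type*} [TopologicalSpace X] [T2Space X] [LocallyCompactSpace X] [MeasurableSpace X]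
  [BorelSpace X] {ι : Type*} [Countable ι] {κ : X → X → EReal} {c : ℝ≥0}

/-- The energy of `∑_{i ∈ I⁺} μⁱ - ∑_{i ∈ I⁻} μⁱ` as a real number. -/
theorem energy_eq (h : PosDefKernel κ c) (A : Condenser X ι) {μ : A.Measures}
    (hp : A.sumOver μ A.Ipos ∈ FiniteEnergyPlus κ) (hn : A.sumOver μ A.Ineg ∈ FiniteEnergyPlus κ) :
    A.energy κ μ = ((mutualReal κ (A.sumOver μ A.Ipos) (A.sumOver μ A.Ipos) +
      mutualReal κ (A.sumOver μ A.Ineg) (A.sumOver μ A.Ineg) -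
      2 * mutualReal κ (A.sumOver μ A.Ipos) (A.sumOver μ A.Ineg) : ℝ) : EReal) := by
  have h1 : A.energy κ μ =
      (posMutual κ (A.sumOver μ A.Ipos) (A.sumOver μ A.Ipos) +
        posMutual κ (A.sumOver μ A.Ineg) (A.sumOver μ A.Ineg)) -
      (posMutual κ (A.sumOver μ A.Ipos) (A.sumOver μ A.Ineg) +
        posMutual κ (A.sumOver μ A.Ineg) (A.sumOver μ A.Ipos)) := rfl
  rw [h1, h.coe_mutualReal hp hp, h.coe_mutualReal hn hn, h.coe_mutualReal hp hn,
    h.coe_mutualReal hn hp, h.mutualReal_comm (A.sumOver μ A.Ineg) (A.sumOver μ A.Ipos), two_mul]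
  rfl

theorem R_mem_finiteEnergy_iff (h : PosDefKernel κ c) (A : Condenser X ι) (μ : A.Measures) :
    A.R μ ∈ FiniteEnergy κ ↔ A.sumOver μ A.Ipos ∈ FiniteEnergyPlus κ ∧
      A.sumOver μ A.Ineg ∈ FiniteEnergyPlus κ := by
  refine ⟨fun hR => ?_, fun ⟨hp, hn⟩ => ?_⟩
  · have hR' := h.pos_neg_mem hR
    exact hR'
  have heq : mutualEnergy κ (A.R μ) (A.R μ) = _ := A.energy_eq h hp hn
  change mutualEnergy κ (A.R μ) (A.R μ) ≠ ⊥ ∧ mutualEnergy κ (A.R μ) (A.R μ) ≠ ⊤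
  rw [heq]
  exact ⟨EReal.coe_ne_bot _, EReal.coe_ne_top _⟩

/-- On its plate `g i` is at least its infimum, so the constraint bounds the mass of each coordinate
by the corresponding term. -/
theorem sumOver_univ_le (A : Condenser X ι) {a : ι → ℝ} (ha : ∀ i, 0 < a i) {g : ι → X → ℝ}
    {μ : A.Measures}
    (hμ : ∀ i, ∫⁻ x, ENNReal.ofReal (g i x) ∂(μ i).1.toMeasure = ENNReal.ofReal (a i))
    (J : Set ι) : (A.sumOver μ J).toMeasure univ ≤
      ∑' i, ENNReal.ofReal (a i) / ⨅ x ∈ A.plate i, ENNReal.ofReal (g i x) := by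
  change Measure.sum (fun i : J => (μ i).1.toMeasure) univ ≤ _
  rw [Measure.sum_apply _ MeasurableSet.univ]
  refine (ENNReal.tsum_le_tsum fun i : J => ?_).trans
    (ENNReal.tsum_comp_le_tsum_of_injective Subtype.val_injective
      fun i => ENNReal.ofReal (a i) / ⨅ x ∈ A.plate i, ENNReal.ofReal (g i x))
  obtain ⟨x₀, hx₀⟩ := A.nonempty i
  have hfin : (⨅ x ∈ A.plate i, ENNReal.ofReal (g i x)) ≠ ⊤ :=
    ne_top_of_le_ne_top ENNReal.ofReal_ne_top (iInf₂_le x₀ hx₀)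
  rw [ENNReal.le_div_iff_mul_le (.inr (by simpa using ha i)) (.inl hfin), ← hμ i, mul_comm,
    ← lintegral_const]
  refine lintegral_mono_ae ?_
  filter_upwards [show ∀ᵐ x ∂(μ i).1.toMeasure, x ∈ A.plate i from (μ i).2] with x hx
  exact iInf₂_le x hx

theorem ae_mem_biUnion_plate (A : Condenser X ι) (μ : A.Measures) (J : Set ι) :
    ∀ᵐ x ∂(A.sumOver μ J).toMeasure, x ∈ ⋃ i ∈ J, A.plate i := by
  change ∀ᵐ x ∂(Measure.sum fun i : J => (μ i).1.toMeasure), _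
  rw [Measure.ae_sum_iff]
  intro i
  filter_upwards [show ∀ᵐ x ∂(μ i).1.toMeasure, x ∈ A.plate i from (μ i).2] with x hx
  exact mem_biUnion i.2 hx

/-- Under the standing assumption the mutual energy of the positive and the negative part of an
admissible measure is bounded above. -/
theorem exists_mutualReal_le (h : PosDefKernel κ c) (A : Condenser X ι) {a : ι → ℝ}
    (ha : ∀ i, 0 < a i) {g : ι → X → ℝ}
    (hstanding : A.Ineg = ∅ ∨
      ((∑' i, ENNReal.ofReal (a i) / ⨅ x ∈ A.plate i, ENNReal.ofReal (g i x)) < ⊤ ∧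
        (⨆ x ∈ A.posUnion, ⨆ y ∈ A.negUnion, κ x y) < ⊤)) :
    ∃ D : ℝ, ∀ μ ∈ A.admissible κ a g,
      mutualReal κ (A.sumOver μ A.Ipos) (A.sumOver μ A.Ineg) ≤ D := by
  rcases hstanding with hempty | ⟨hsum, hsup⟩
  · refine ⟨0, fun μ _ => ?_⟩
    have h0 : A.sumOver μ A.Ineg = 0 := by
      refine PosRadon.ext ?_
      have : IsEmpty A.Ineg := isEmpty_coe_sort.2 hempty
      exact Measure.sum_of_isEmpty _
    rw [h0, h.mutualReal_comm, h.mutualReal_zero_left]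
  · set σ := ∑' i, ENNReal.ofReal (a i) / ⨅ x ∈ A.plate i, ENNReal.ofReal (g i x) with hσ
    set S : EReal := ⨆ x ∈ A.posUnion, ⨆ y ∈ A.negUnion, κ x y with hS
    -- `M` bounds `κ + c` between opposite plates and `σ` bounds both total masses, whence the bound
    -- `M * σ * σ`.
    let M : ℝ≥0∞ := (S + (c : ℝ)).toENNReal
    have hM : M ≠ ⊤ := by
      rw [EReal.toENNReal_ne_top_iff]
      exact (EReal.add_lt_top hsup.ne (EReal.coe_ne_top _)).ne
    refine ⟨(M * σ * σ).toReal, fun μ hμ => ?_⟩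
    obtain ⟨hp, hn⟩ := (A.R_mem_finiteEnergy_iff h μ).1 hμ.2
    have hfin := h.shiftMutual_ne_top hp hn
    have hle : shiftMutual κ c (A.sumOver μ A.Ipos) (A.sumOver μ A.Ineg) ≤ M * σ * σ := by
      calc shiftMutual κ c (A.sumOver μ A.Ipos) (A.sumOver μ A.Ineg)
          ≤ ∫⁻ _, M * σ ∂(A.sumOver μ A.Ipos).toMeasure := by
            refine lintegral_mono_ae ?_
            filter_upwards [A.ae_mem_biUnion_plate μ A.Ipos] with x hx
            calc ∫⁻ y, shiftKernel κ c x y ∂(A.sumOver μ A.Ineg).toMeasure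
                ≤ ∫⁻ _, M ∂(A.sumOver μ A.Ineg).toMeasure := by
                  refine lintegral_mono_ae ?_
                  filter_upwards [A.ae_mem_biUnion_plate μ A.Ineg] with y hy
                  refine EReal.toENNReal_le_toENNReal (add_le_add_left ?_ _)
                  exact le_trans (le_iSup₂ (f := fun y (_ : y ∈ A.negUnion) => κ x y) y hy)
                    (le_iSup₂ (f := fun x (_ : x ∈ A.posUnion) => ⨆ y ∈ A.negUnion, κ x y) x hx)
              _ ≤ M * σ := by
                  rw [lintegral_const]
                  gcongr
                  exact A.sumOver_univ_le ha hμ.1 A.Ineg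
        _ ≤ M * σ * σ := by
            rw [lintegral_const]
            gcongr
            exact A.sumOver_univ_le ha hμ.1 A.Ipos
    rw [h.mutualReal_eq hfin]
    have h1 := ENNReal.toReal_mono
      (ENNReal.mul_ne_top (ENNReal.mul_ne_top hM hsum.ne) hsum.ne) hle
    have h2 : 0 ≤ c * ((A.sumOver μ A.Ineg).toMeasure univ).toReal *
        ((A.sumOver μ A.Ipos).toMeasure univ).toReal := by positivity
    linarith

/-- On a compact set `g` has a positive minimum. This is the vague boundedness of admissible
coordinates. -/
theorem exists_measure_le_of_lintegral_eq {g : X → ℝ} (hg : Continuous g) (hpos : ∀ x, 0 < g x)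
    (a : ℝ) {K : Set X} (hK : IsCompact K) : ∃ C : ℝ≥0, ∀ μ : PosRadon X,
      ∫⁻ x, ENNReal.ofReal (g x) ∂μ.toMeasure = ENNReal.ofReal a → μ.toMeasure K ≤ C := by
  rcases K.eq_empty_or_nonempty with rfl | hne
  · exact ⟨0, fun μ _ => by simp⟩
  obtain ⟨x₀, -, hx₀⟩ := hK.exists_isMinOn hne hg.continuousOn
  refine ⟨(a / g x₀).toNNReal, fun μ hμ => ?_⟩
  change _ ≤ ENNReal.ofReal (a / g x₀)
  rw [ENNReal.ofReal_div_of_pos (hpos x₀),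
    ENNReal.le_div_iff_mul_le (.inl (by simpa using hpos x₀)) (.inl ENNReal.ofReal_ne_top),
    ← hμ, mul_comm, ← setLIntegral_const]
  exact (setLIntegral_mono' hK.measurableSet fun x hx => ENNReal.ofReal_le_ofReal (hx₀ hx)).trans
    (setLIntegral_le_lintegral _ _)

/-- Lower semicontinuity of the energy along weakly convergent bounded filters. -/
theorem energy_le_of_tendsto (h : PosDefKernel κ c) (A : Condenser X ι) {l : Filter A.Measures}
    [l.NeBot] {μ₀ : A.Measures} (hp₀ : A.sumOver μ₀ A.Ipos ∈ FiniteEnergyPlus κ)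
    (hn₀ : A.sumOver μ₀ A.Ineg ∈ FiniteEnergyPlus κ)
    (hmem : ∀ᶠ μ in l, A.sumOver μ A.Ipos ∈ FiniteEnergyPlus κ ∧
      A.sumOver μ A.Ineg ∈ FiniteEnergyPlus κ)
    (hp : ∀ ν ∈ FiniteEnergyPlus κ, Tendsto (fun μ => mutualReal κ (A.sumOver μ A.Ipos) ν) l
      (𝓝 (mutualReal κ (A.sumOver μ₀ A.Ipos) ν)))
    (hn : ∀ ν ∈ FiniteEnergyPlus κ, Tendsto (fun μ => mutualReal κ (A.sumOver μ A.Ineg) ν) l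
      (𝓝 (mutualReal κ (A.sumOver μ₀ A.Ineg) ν)))
    {e : ℝ} (he : ∀ᶠ μ in l, A.energy κ μ ≤ (e : EReal)) : A.energy κ μ₀ ≤ (e : EReal) := by
  rw [A.energy_eq h hp₀ hn₀, EReal.coe_le_coe_iff]
  set p₀ := A.sumOver μ₀ A.Ipos
  set n₀ := A.sumOver μ₀ A.Ineg
  have hlim := (((hp p₀ hp₀).add (hn n₀ hn₀)).sub ((hp n₀ hn₀).add (hn p₀ hp₀))).const_mul 2
  have hle : ∀ᶠ μ in l, 2 * (mutualReal κ (A.sumOver μ A.Ipos) p₀ +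
      mutualReal κ (A.sumOver μ A.Ineg) n₀ - (mutualReal κ (A.sumOver μ A.Ipos) n₀ +
      mutualReal κ (A.sumOver μ A.Ineg) p₀)) ≤
      e + (mutualReal κ p₀ p₀ + mutualReal κ n₀ n₀ - 2 * mutualReal κ p₀ n₀) := by
    filter_upwards [hmem, he] with μ ⟨hpμ, hnμ⟩ heμ
    rw [A.energy_eq h hpμ hnμ, EReal.coe_le_coe_iff] at heμ
    set p := A.sumOver μ A.Ipos
    set n := A.sumOver μ A.Ineg
    -- The square `‖(p - n) - (p₀ - n₀)‖² ≥ 0` is written for the nonnegative measures `p + n₀` and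
    -- `n + p₀`. It bounds a quantity linear in `p` and `n`, to which weak convergence applies.
    have h1 := h.nonneg_sub (h.add_mem hpμ hn₀) (h.add_mem hnμ hp₀)
    rw [h.mutualReal_add_left hpμ hn₀ (h.add_mem hpμ hn₀),
      h.mutualReal_add_left hnμ hp₀ (h.add_mem hnμ hp₀),
      h.mutualReal_add_left hpμ hn₀ (h.add_mem hnμ hp₀),
      h.mutualReal_add_right hpμ hpμ hn₀, h.mutualReal_add_right hn₀ hpμ hn₀,
      h.mutualReal_add_right hnμ hnμ hp₀, h.mutualReal_add_right hp₀ hnμ hp₀,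
      h.mutualReal_add_right hpμ hnμ hp₀, h.mutualReal_add_right hn₀ hnμ hp₀,
      h.mutualReal_comm n₀ p, h.mutualReal_comm p₀ n, h.mutualReal_comm n₀ n,
      h.mutualReal_comm n₀ p₀] at h1
    linarith
  have h2 := le_of_tendsto hlim hle
  rw [h.mutualReal_comm n₀ p₀] at h2
  linarith

/-- Convergence of minimizing ultrafilters to minimizers. -/
theorem exists_minimizer_of_ultrafilter (h : PosDefKernel κ c)
    (hw : WeaklyConsistent κ) (A : Condenser X ι)
    {g : ι → X → ℝ} (hg_cont : ∀ i, Continuous (g i)) (hg_pos : ∀ i x, 0 < g i x)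
    {a : ι → ℝ} (ha : ∀ i, 0 < a i)
    (hstanding : A.Ineg = ∅ ∨
      ((∑' i, ENNReal.ofReal (a i) / ⨅ x ∈ A.plate i, ENNReal.ofReal (g i x)) < ⊤ ∧
        (⨆ x ∈ A.posUnion, ⨆ y ∈ A.negUnion, κ x y) < ⊤))
    (hgrowth : ∀ i, BddAbove (g i '' A.plate i) ∨
      ∃ r : ℝ, 1 < r ∧ ∃ ω ∈ FiniteEnergy κ,
        NearlyEverywhere κ (A.plate i)
          (fun x => ((g i x ^ r : ℝ) : EReal) ≤ potential κ ω x))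
    (hplates : ∀ i, IsCompact (A.plate i) ∨ interiorCapacity κ (A.plate i) < ⊤)
    (U : Ultrafilter A.Measures) (hU : A.admissible κ a g ∈ U) {m : ℝ}
    (hm : A.minEnergy κ a g = m)
    (hUm : ∀ ε : ℝ, 0 < ε → ∀ᶠ μ in (U : Filter A.Measures), A.energy κ μ ≤ (m + ε : ℝ)) :
    ∃ μ ∈ A.minimizers κ a g, (U : Filter A.Measures) ≤ 𝓝 μ := by
  have hlim : ∀ i, ∃ ν : PosRadon X, ν.toMeasure (A.plate i)ᶜ = 0 ∧
      Tendsto (fun μ : A.Measures => (μ i).1) U (𝓝 ν) := fun i =>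
    exists_tendsto_of_ultrafilter U _ (A.closed i) (fun μ => (μ i).2) fun K hK => by
      obtain ⟨C, hC⟩ := exists_measure_le_of_lintegral_eq (hg_cont i) (hg_pos i) (a i) hK
      refine ⟨C, ?_⟩
      filter_upwards [hU] with μ hμ using hC _ (hμ.1 i)
  choose ν hν hUν using hlim
  let μ₀ : A.Measures := fun i => ⟨ν i, hν i⟩
  have hUμ₀ : (U : Filter A.Measures) ≤ 𝓝 μ₀ := by
    rw [← tendsto_id', tendsto_pi_nhds]
    exact fun i => tendsto_subtype_rng.2 (hUν i)
  have hmem : ∀ᶠ μ in (U : Filter A.Measures), A.sumOver μ A.Ipos ∈ FiniteEnergyPlus κ ∧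
      A.sumOver μ A.Ineg ∈ FiniteEnergyPlus κ := by
    filter_upwards [hU] with μ hμ using (A.R_mem_finiteEnergy_iff h μ).1 hμ.2
  obtain ⟨D, hD⟩ := A.exists_mutualReal_le h ha hstanding
  -- The energies of the two halves are nonnegative, and their sum is the total energy, eventually
  -- at most `m + 1`, plus twice a mutual energy bounded by `D`.
  have hbdd : ∀ᶠ μ in (U : Filter A.Measures),
      mutualReal κ (A.sumOver μ A.Ipos) (A.sumOver μ A.Ipos) ≤ m + 1 + 2 * D ∧
      mutualReal κ (A.sumOver μ A.Ineg) (A.sumOver μ A.Ineg) ≤ m + 1 + 2 * D := by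
    filter_upwards [hU, hmem, hUm 1 one_pos] with μ hμ ⟨hp, hn⟩ he
    rw [A.energy_eq h hp hn, EReal.coe_le_coe_iff] at he
    have h1 := hD μ hμ
    have h2 := h.mutualReal_self_nonneg hp
    have h3 := h.mutualReal_self_nonneg hn
    constructor <;> linarith
  have hweak : ∀ J : Set ι,
      (∀ᶠ μ in (U : Filter A.Measures), A.sumOver μ J ∈ FiniteEnergyPlus κ) →
      (∀ᶠ μ in (U : Filter A.Measures),
        mutualReal κ (A.sumOver μ J) (A.sumOver μ J) ≤ m + 1 + 2 * D) →
      A.sumOver μ₀ J ∈ FiniteEnergyPlus κ ∧ ∀ ρ ∈ FiniteEnergyPlus κ,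
        Tendsto (fun μ => mutualReal κ (A.sumOver μ J) ρ) U
          (𝓝 (mutualReal κ (A.sumOver μ₀ J) ρ)) := fun J h1 h2 =>
    hw (map (fun μ => A.sumOver μ J) U) inferInstance h1 ⟨_, h2⟩ _
      (((A.continuous_sumOver J).tendsto μ₀).mono_left hUμ₀)
  obtain ⟨hp₀, hp⟩ := hweak A.Ipos (hmem.mono fun _ h => h.1) (hbdd.mono fun _ h => h.1)
  obtain ⟨hn₀, hn⟩ := hweak A.Ineg (hmem.mono fun _ h => h.2) (hbdd.mono fun _ h => h.2)
  have htight : ∀ i, ∀ η : ℝ≥0, 0 < η → ∃ K : Set X, IsCompact K ∧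
      ∀ᶠ μ in (U : Filter A.Measures),
        ∫⁻ x in Kᶜ, ENNReal.ofReal (g i x) ∂(μ i).1.toMeasure ≤ η := by
    intro i η hη
    -- On a compact space tightness is trivial. On a noncompact one `c = 0`, so the estimates for
    -- nonnegative kernels apply.
    by_cases hX : CompactSpace X
    · exact ⟨univ, isCompact_univ, .of_forall fun μ => by simp⟩
    obtain rfl : c = 0 := by
      by_contra h0
      exact hX (h.bound.compact h0)
    obtain ⟨K, hK, hKμ⟩ := h.exists_isCompact_setLIntegral_compl_le hw (A.closed i) (hplates i)
      (hg_cont i) (hg_pos i) (hgrowth i) (m + 1 + 2 * D).toNNReal hη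
    refine ⟨K, hK, ?_⟩
    filter_upwards [hU, hmem, hbdd] with μ hμ ⟨hpμ, hnμ⟩ ⟨hpb, hnb⟩
    refine hKμ _ (μ i).2 ?_ (by rw [hμ.1 i]; exact ENNReal.ofReal_ne_top)
    have key : ∀ J : Set ι, i ∈ J → A.sumOver μ J ∈ FiniteEnergyPlus κ →
        mutualReal κ (A.sumOver μ J) (A.sumOver μ J) ≤ m + 1 + 2 * D →
        shiftMutual κ 0 (μ i).1 (μ i).1 ≤ ((m + 1 + 2 * D).toNNReal : ℝ≥0∞) := by
      intro J hi hJ hJb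
      -- As `κ ≥ 0`, each coordinate has at most the energy of the half containing it.
      refine (shiftMutual_mono (A.le_sumOver μ hi) (A.le_sumOver μ hi)).trans ?_
      rw [h.mutualReal_eq_toReal] at hJb
      exact ENNReal.le_ofReal_iff_toReal_le ((h.mem_finiteEnergyPlus_iff _).1 hJ)
        (ENNReal.toReal_nonneg.trans hJb) |>.2 hJb
    by_cases hi : i ∈ A.Ipos
    · exact key A.Ipos hi hpμ hpb
    · exact key A.Ineg hi hnμ hnb
  have hadm : μ₀ ∈ A.admissible κ a g := by
    -- The upper bound is lower semicontinuity of the integral; the lower bound uses tightness.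
    refine ⟨fun i => le_antisymm ?_ ?_, (A.R_mem_finiteEnergy_iff h μ₀).2 ⟨hp₀, hn₀⟩⟩
    · refine lintegral_le_of_tendsto (hUν i) ?_ (mem_of_superset hU fun μ hμ => (hμ.1 i).le)
      exact (ENNReal.continuous_ofReal.comp (hg_cont i)).lowerSemicontinuous
    · exact le_lintegral_of_tendsto (hUν i) (hg_cont i)
        (mem_of_superset hU fun μ hμ => (hμ.1 i).ge) (htight i)
  refine ⟨μ₀, ⟨hadm, le_antisymm ?_ (iInf₂_le μ₀ hadm)⟩, hUμ₀⟩
  rw [hm]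
  refine EReal.le_of_forall_lt_iff_le.1 fun z hz => ?_
  have hε : 0 < z - m := sub_pos.2 (EReal.coe_lt_coe_iff.1 hz)
  have := A.energy_le_of_tendsto h hp₀ hn₀ hmem hp hn (hUm (z - m) hε)
  rwa [add_sub_cancel] at this

end Condenser

end CondenserEnergy

/-! ### Existence and vague compactness of minimizers. -/

theorem mainTheorem1
    {X : Type*} [TopologicalSpace X] [T2Space X] [LocallyCompactSpace X]
    [MeasurableSpace X] [BorelSpace X]
    {ι : Type*} [Countable ι]
    (κ : X → X → EReal) (hκ : IsKernel κ) (hκ_posdef : IsPosDef κ) (hκ_cons : IsConsistent κ)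
    (A : Condenser X ι)
    (g : ι → X → ℝ) (hg_cont : ∀ i, Continuous (g i)) (hg_pos : ∀ i x, 0 < g i x)
    (a : ι → ℝ) (ha : ∀ i, 0 < a i)
    (hcap : 0 < A.cap κ a g)
    (hstanding : A.Ineg = ∅ ∨
      ((∑' i, ENNReal.ofReal (a i) / ⨅ x ∈ A.plate i, ENNReal.ofReal (g i x)) < ⊤ ∧
        (⨆ x ∈ A.posUnion, ⨆ y ∈ A.negUnion, κ x y) < ⊤))
    (hgrowth : ∀ i, BddAbove (g i '' A.plate i) ∨
      ∃ r : ℝ, 1 < r ∧ ∃ ω ∈ FiniteEnergy κ,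
        NearlyEverywhere κ (A.plate i)
          (fun x => ((g i x ^ r : ℝ) : EReal) ≤ potential κ ω x))
    (hplates : ∀ i, IsCompact (A.plate i) ∨ interiorCapacity κ (A.plate i) < ⊤) :
    (A.minimizers κ a g).Nonempty ∧ IsCompact (A.minimizers κ a g) := by
  obtain ⟨c, hc⟩ := hκ.exists_lowerBoundedBy
  have h : PosDefKernel κ c := ⟨hκ, hκ_posdef, hc⟩
  have hw := IsConsistent.weaklyConsistent h hκ_cons
  -- Positive definiteness applies since the positive part of the energy is finite, so the form `∞ -
  -- ∞` cannot occur.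
  have hnonneg : 0 ≤ A.minEnergy κ a g := by
    refine le_iInf₂ fun μ hμ => hκ_posdef.2 _ fun hdef => ?_
    obtain ⟨hp, hn⟩ := (A.R_mem_finiteEnergy_iff h μ).1 hμ.2
    have h1 : mutualPos κ (A.R μ) (A.R μ) =
        posMutual κ (A.sumOver μ A.Ipos) (A.sumOver μ A.Ipos) +
          posMutual κ (A.sumOver μ A.Ineg) (A.sumOver μ A.Ineg) := rfl
    rw [h1, h.coe_mutualReal hp hp, h.coe_mutualReal hn hn, ← EReal.coe_add] at hdef
    exact EReal.coe_ne_top _ hdef.1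
  have hne_top : A.minEnergy κ a g ≠ ⊤ := by
    rw [Condenser.cap, ENNReal.inv_pos] at hcap
    exact EReal.toENNReal_ne_top_iff.1 hcap
  obtain ⟨m, hm⟩ : ∃ m : ℝ, A.minEnergy κ a g = m :=
    ⟨_, (EReal.coe_toReal hne_top (ne_bot_of_le_ne_bot (by simp) hnonneg)).symm⟩
  constructor
  · have hseq : ∀ n : ℕ, ∃ μ ∈ A.admissible κ a g,
        A.energy κ μ < ((m + 1 / ((n : ℝ) + 1) : ℝ) : EReal) := fun n => by
      have hlt : A.minEnergy κ a g < ((m + 1 / ((n : ℝ) + 1) : ℝ) : EReal) := by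
        rw [hm, EReal.coe_lt_coe_iff]
        have : 0 < 1 / ((n : ℝ) + 1) := by positivity
        linarith
      obtain ⟨μ, hμ⟩ := iInf_lt_iff.1 hlt
      obtain ⟨hμ1, hμ2⟩ := iInf_lt_iff.1 hμ
      exact ⟨μ, hμ1, hμ2⟩
    choose u hu hum using hseq
    obtain ⟨μ, hμ, -⟩ := A.exists_minimizer_of_ultrafilter h hw hg_cont hg_pos ha hstanding hgrowth
      hplates ((hyperfilter ℕ).map u) (Ultrafilter.mem_map.2 (univ_mem' hu)) hm
      fun ε hε => by
        have hev : ∀ᶠ n : ℕ in atTop, 1 / ((n : ℝ) + 1) < ε :=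
          tendsto_one_div_add_atTop_nhds_zero_nat.eventually (gt_mem_nhds hε)
        refine Nat.hyperfilter_le_atTop (hev.mono fun n hn => (hum n).le.trans ?_)
        rw [EReal.coe_le_coe_iff]
        linarith
    exact ⟨μ, hμ⟩
  -- On the set of minimizers the energy is constantly `m`, so every ultrafilter on it is
  -- minimizing.
  · rw [isCompact_iff_ultrafilter_le_nhds]
    intro U hU
    have hU' : A.minimizers κ a g ∈ U := le_principal_iff.1 hU
    refine A.exists_minimizer_of_ultrafilter h hw hg_cont hg_pos ha hstanding hgrowth
      hplates U (mem_of_superset hU' fun μ hμ => hμ.1) hm fun ε hε => ?_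
    filter_upwards [hU'] with μ hμ
    rw [hμ.2, hm, EReal.coe_le_coe_iff]
    linarith
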